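/- Let $(\xi_n)_{n\in\mathbb Z}$ be a (strictly) stationary Markov chain on a probability space $(\Omega,\mathcal F,\mathbb P)$ with values in a measurable space $(S,\mathcal A)$, and let $\pi$ be the law of $\xi_0$. Assume that the chain is totally ergodic, i.e. for every integer $m\ge 1$ the power $\theta^m$ of the shift $\theta$ on $S^{\mathbb Z}$ is ergodic with respect to the law of $(\xi_n)_{n\in\mathbb Z}$. Let $f:S\to\mathbb R$ be measurable with $\int f^2\,d\pi<\infty$ and $\int f\,d\pi=0$, and put $X_i=f(\xi_i)$, $S_n=\sum_{i=1}^n X_i$; let $\|\cdot\|$ be the norm of $L^2(\Omega,\mathcal F,\mathbb P)$. Assume that $$\sup_{n\ge 1}\frac{E(S_n^2)}{n}<\infty\qquad\text{and}\qquad \lim_{n\to\infty} n\,\|E(X_0\mid \xi_{-n},\xi_n)\|^2=0 .$$ Then there is $\sigma^2\in[0,\infty)$ such that $$\lim_{n\to\infty}\frac1n\|S_n-E(S_n\mid\xi_0,\xi_n)\|^2=\sigma^2,\qquad \lim_{n\to\infty}\frac{E(S_n^2)}{n}=\sigma^2,\qquad \frac{S_n}{\sqrt n}\Rightarrow N(0,\sigma^2),$$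 where $\Rightarrow$ denotes convergence in distribution and $N(0,0)$ is the point mass at $0$. -/

import Mathlib

open MeasureTheory ProbabilityTheory Filter Topology
open scoped NNReal ENNReal

namespace MarkovCLT

variable {Ω S : Type*} [MeasurableSpace Ω] [MeasurableSpace S]

/-- The left shift `θ` on two-sided sequences: `(θ x) n = x (n + 1)`. -/
def shift (x : ℤ → S) : ℤ → S := fun n => x (n + 1)

/-- The law of the whole process `(ξ n)_{n ∈ ℤ}` on the space of two-sided sequences, equipped
with the product sigma-algebra. -/
noncomputable def pathLaw (P : Measure Ω) (ξ : ℤ → Ω → S) : Measure (ℤ → S) :=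
  P.map (fun ω n => ξ n ω)

/-- The sigma-algebra of the past, generated by all `ξ k` with `k ≤ n`. -/
abbrev past (ξ : ℤ → Ω → S) (n : ℤ) : MeasurableSpace Ω :=
  ⨆ k : ℤ, ⨆ _ : k ≤ n, MeasurableSpace.comap (ξ k) inferInstance

/-- The sigma-algebra generated by one variable `ξ n`. -/
abbrev present (ξ : ℤ → Ω → S) (n : ℤ) : MeasurableSpace Ω :=
  MeasurableSpace.comap (ξ n) inferInstance

/-- The Markov property: `P(ξ (n+1) ∈ A | ξ k, k ≤ n) = P(ξ (n+1) ∈ A | ξ n)` almost surely, for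
all times `n` and all measurable sets `A`. -/
def HasMarkovProperty (P : Measure Ω) (ξ : ℤ → Ω → S) : Prop :=
  ∀ (n : ℤ) (A : Set S), MeasurableSet A →
    P[(ξ (n + 1) ⁻¹' A).indicator (fun _ => (1 : ℝ)) | past ξ n] =ᵐ[P]
      P[(ξ (n + 1) ⁻¹' A).indicator (fun _ => (1 : ℝ)) | present ξ n]

/-- A (strictly) stationary Markov chain indexed by `ℤ`. -/
structure IsStationaryMarkovChain (P : Measure Ω) (ξ : ℤ → Ω → S) : Prop where
  measurable : ∀ n, Measurable (ξ n)
  stationary : (pathLaw P ξ).map shift = pathLaw P ξ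
  markov : HasMarkovProperty P ξ

/-- Total ergodicity: every power `θ^m`, `m ≥ 1`, of the shift is ergodic under the law of the
process. -/
def IsTotallyErgodic (P : Measure Ω) (ξ : ℤ → Ω → S) : Prop :=
  ∀ m : ℕ, 1 ≤ m → Ergodic (shift^[m]) (pathLaw P ξ)

/-- The partial sum `S_n = f (ξ 1) + ... + f (ξ n)`. -/
def partialSum (f : S → ℝ) (ξ : ℤ → Ω → S) (n : ℕ) (ω : Ω) : ℝ :=
  ∑ i ∈ Finset.Icc 1 n, f (ξ (i : ℤ) ω)

/-- The conditional expectation `E(Y | ξ a, ξ b)`. -/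
noncomputable def condPair (P : Measure Ω) (ξ : ℤ → Ω → S) (a b : ℤ) (Y : Ω → ℝ) : Ω → ℝ :=
  P[Y | MeasurableSpace.comap (ξ a) inferInstance ⊔ MeasurableSpace.comap (ξ b) inferInstance]

/-- The squared norm of `Y` in `L²(P)`; only used for square integrable `Y`. -/
noncomputable def sqNorm (P : Measure Ω) (Y : Ω → ℝ) : ℝ :=
  ∫ ω, (Y ω) ^ 2 ∂P

end MarkovCLT

/-! Split the sum over a block of length `m` into its conditional mean given the chain at both ends
and the remaining noise. By the Markov property, used in both time directions, conditioning on the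
two ends is the same as conditioning on everything outside the block (`condExp_outer`). The noise is
therefore orthogonal to every square integrable variable that depends only on times outside the open
block (`integral_mul_blockNoise_eq_zero`).

Three consequences carry the proof. First, the noise variance `a m` is superadditive
(`blockNoise_superadditive`) and at most `E(S_m²)`, so by Fekete `a m / m` tends to some finite `v`.
Second, the mean of a term in the block is controlled by its distance to the nearest end, and the
assumption on `E(X_0 | ξ_{-n}, ξ_n)` makes the norm of the block mean `o(√m)`
(`tendsto_l2_blockMean_sq_div`); hence `E(S_n²)/n` has the same limit `v`. Third, for fixed `m` the
noises of successive blocks are martingale differences, stationary and ergodic under `θ^m`, which is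
where total ergodicity enters; their normalized sums converge to a normal law of variance `a m / m`
(`tendsto_integral_cis_birkhoffSum`).

The noises are also orthogonal to all block means. So for `S_{mk}` the sum of the means has squared
norm exactly `E(S_{mk}²) - k a m`, which after division by `mk` tends to `v - a m / m`. This is
small for large `m`, although nothing is said about correlations between the means. Letting `k → ∞`
and then `m → ∞` gives the theorem (`tendsto_integral_cis_partialSum`). -/

namespace MarkovCLT

set_option linter.unusedSectionVars false

/-! ### The `L²` norm and measure-preserving maps -/

section L2

variable {Ω X : Type*} {mΩ : MeasurableSpace Ω} {mX : MeasurableSpace X}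
  {P : Measure Ω} {μ : Measure X}

/-- The `L²` norm of a real function, as a real number. -/
noncomputable def l2 (P : Measure Ω) (Y : Ω → ℝ) : ℝ := (eLpNorm Y 2 P).toReal

lemma l2_nonneg (Y : Ω → ℝ) : 0 ≤ l2 P Y := ENNReal.toReal_nonneg

lemma l2_congr {Y Z : Ω → ℝ} (h : Y =ᵐ[P] Z) : l2 P Y = l2 P Z := by
  unfold l2; rw [eLpNorm_congr_ae h]

lemma l2_sq {Y : Ω → ℝ} (hY : MemLp Y 2 P) : l2 P Y ^ 2 = ∫ ω, Y ω ^ 2 ∂P := by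
  unfold l2
  rw [hY.eLpNorm_eq_integral_rpow_norm (by simp) (by simp)]
  have h0 : 0 ≤ ∫ a, ‖Y a‖ ^ (2 : ℝ≥0∞).toReal ∂P :=
    integral_nonneg fun a => by positivity
  rw [ENNReal.toReal_ofReal (by positivity), ← Real.rpow_natCast, ← Real.rpow_mul h0]
  simp

lemma l2_eq_sqrt {Y : Ω → ℝ} (hY : MemLp Y 2 P) : l2 P Y = √(∫ ω, Y ω ^ 2 ∂P) := by
  rw [← l2_sq hY, Real.sqrt_sq (l2_nonneg Y)]

lemma l2_add_le {Y Z : Ω → ℝ} (hY : MemLp Y 2 P) (hZ : MemLp Z 2 P) :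
    l2 P (Y + Z) ≤ l2 P Y + l2 P Z := by
  unfold l2
  rw [← ENNReal.toReal_add hY.2.ne hZ.2.ne]
  exact ENNReal.toReal_mono (ENNReal.add_ne_top.2 ⟨hY.2.ne, hZ.2.ne⟩)
    (eLpNorm_add_le hY.1 hZ.1 (by norm_num))

lemma l2_const_mul (c : ℝ) (Y : Ω → ℝ) : l2 P (fun ω => c * Y ω) = |c| * l2 P Y := by
  unfold l2
  have := eLpNorm_const_smul (μ := P) c Y 2
  rw [show (fun ω => c * Y ω) = c • Y from rfl, this]
  simp

lemma l2_sum_le {ι : Type*} (s : Finset ι) {Y : ι → Ω → ℝ} (hY : ∀ i ∈ s, MemLp (Y i) 2 P) :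
    l2 P (∑ i ∈ s, Y i) ≤ ∑ i ∈ s, l2 P (Y i) := by
  unfold l2
  rw [← ENNReal.toReal_sum fun i hi => (hY i hi).2.ne]
  exact ENNReal.toReal_mono (ENNReal.sum_ne_top.2 fun i hi => (hY i hi).2.ne)
    (eLpNorm_sum_le (fun i hi => (hY i hi).1) (by norm_num))

lemma integral_abs_le_l2 [IsProbabilityMeasure P] {Y : Ω → ℝ} (hY : MemLp Y 2 P) :
    ∫ ω, |Y ω| ∂P ≤ l2 P Y := by
  have h1 : ∫ ω, |Y ω| ∂P = (eLpNorm Y 1 P).toReal := by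
    rw [eLpNorm_one_eq_lintegral_enorm, ← integral_norm_eq_lintegral_enorm hY.1]
    rfl
  rw [h1]
  exact ENNReal.toReal_mono hY.2.ne (eLpNorm_le_eLpNorm_of_exponent_le (by norm_num) hY.1)

lemma l2_comp {φ : Ω → X} (hφ : MeasurePreserving φ P μ) {Y : X → ℝ}
    (hY : AEStronglyMeasurable Y μ) : l2 P (Y ∘ φ) = l2 μ Y := by
  unfold l2
  rw [eLpNorm_comp_measurePreserving hY hφ]

lemma l2_condExp_le {m : MeasurableSpace Ω} {Y : Ω → ℝ} (hY : MemLp Y 2 P) :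
    l2 P (P[Y | m]) ≤ l2 P Y :=
  ENNReal.toReal_mono hY.2.ne (eLpNorm_condExp_le_eLpNorm Y (by norm_num))

lemma _root_.MeasureTheory.MeasurePreserving.integral_comp_ae {E : Type*} [NormedAddCommGroup E]
    [NormedSpace ℝ E] {φ : Ω → X} (hφ : MeasurePreserving φ P μ)
    {g : X → E} (hg : AEStronglyMeasurable g μ) : ∫ ω, g (φ ω) ∂P = ∫ x, g x ∂μ := by
  rw [← hφ.map_eq] at hg ⊢
  rw [integral_map hφ.aemeasurable hg]

end L2

/-! ### Transport and orthogonality of conditional expectations -/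

section CondExp

variable {Ω : Type*} {mΩ : MeasurableSpace Ω} {P : Measure Ω}

/-- Sets of the pulled back σ-algebra are preimages, so the defining integrals agree by change of
variables. -/
lemma condExp_comp {Ω X : Type*} {mΩ : MeasurableSpace Ω} {m mX : MeasurableSpace X}
    {P : Measure Ω} {μ : Measure X} [IsFiniteMeasure P] [IsFiniteMeasure μ] {φ : Ω → X}
    (hφ : MeasurePreserving φ P μ) (hm : m ≤ mX) {g : X → ℝ}
    (hg : Integrable g μ) : (μ[g | m]) ∘ φ =ᵐ[P] P[g ∘ φ | m.comap φ] := by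
  have hle : m.comap φ ≤ mΩ := (MeasurableSpace.comap_mono hm).trans hφ.measurable.comap_le
  refine ae_eq_condExp_of_forall_setIntegral_eq hle (hφ.integrable_comp_of_integrable hg)
    (fun s _ _ => ((hφ.integrable_comp_of_integrable integrable_condExp).integrableOn)) ?_ ?_
  · rintro s ⟨t, ht, rfl⟩ -
    have key : ∀ h : X → ℝ, Integrable h μ →
        ∫ ω in φ ⁻¹' t, (h ∘ φ) ω ∂P = ∫ x in t, h x ∂μ := by
      intro h hh
      have := hφ.restrict_preimage (hm t ht)
      exact this.integral_comp_ae hh.1.restrict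
    rw [key _ integrable_condExp, key _ hg, setIntegral_condExp hm hg ht]
  · exact (stronglyMeasurable_condExp.comp_measurable
      (comap_measurable φ)).aestronglyMeasurable

/-- The residual of an orthogonal projection is orthogonal to the range. The scalar field is left
open because the residual is tested both against real variables and against complex exponentials. -/
lemma integral_mul_sub_condExp_eq_zero {𝕜 : Type*} [RCLike 𝕜] [IsFiniteMeasure P]
    {m : MeasurableSpace Ω} (hm : m ≤ mΩ)
    {G : Ω → 𝕜} (hG : AEStronglyMeasurable[m] G P) (hG2 : MemLp G 2 P) {Y : Ω → ℝ}
    (hY : MemLp Y 2 P) : ∫ ω, G ω * ((Y ω - (P[Y | m]) ω : ℝ) : 𝕜) ∂P = 0 := by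
  have hY1 : Integrable Y P := hY.integrable (by norm_num)
  have hW : MemLp (Y - P[Y | m]) 2 P := hY.sub (hY.condExp (by norm_num))
  have hW1 := hW.integrable (by norm_num : (1 : ℝ≥0∞) ≤ 2)
  have hWk : MemLp (fun ω => ((Y ω - (P[Y | m]) ω : ℝ) : 𝕜)) 2 P := hW.ofReal
  -- Multiplication of a `𝕜`-valued factor by a real one, as a real bilinear map, so that the
  -- measurable factor can be pulled out of the conditional expectation.
  let B : 𝕜 →L[ℝ] ℝ →L[ℝ] 𝕜 := (ContinuousLinearMap.lsmul ℝ ℝ : ℝ →L[ℝ] 𝕜 →L[ℝ] 𝕜).flip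
  have hB : ∀ (x : 𝕜) (r : ℝ), B x r = x * (r : 𝕜) := by
    intro x r
    simp [B, RCLike.real_smul_eq_coe_mul, mul_comm]
  have hint : Integrable (fun ω => B (G ω) ((Y - P[Y | m]) ω)) P := by
    simp only [hB]
    exact hG2.integrable_mul hWk
  have h1 := condExp_bilin_of_aestronglyMeasurable_left B hG hint hW1
  have h2 : P[Y - P[Y | m] | m] =ᵐ[P] 0 := by
    refine (condExp_sub hY1 integrable_condExp m).trans ?_
    have := condExp_condExp_of_le (le_refl m) hm (μ := P) (f := Y)
    filter_upwards [this] with ω hω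
    simp [hω]
  have h3 := integral_condExp (μ := P) hm (f := fun ω => B (G ω) ((Y - P[Y | m]) ω))
  rw [integral_congr_ae h1] at h3
  have h4 : ∫ ω, B (G ω) ((P[Y - P[Y | m] | m]) ω) ∂P = 0 := by
    rw [integral_congr_ae (g := fun _ => 0), integral_zero]
    filter_upwards [h2] with ω hω
    simp [hω]
  rw [h4] at h3
  simpa [hB] using h3.symm

/-- The form in which Markov properties are applied: `h` trades the large σ-algebra `m` for a
smaller one. With `m' = m` it is the self-adjointness of conditional expectation. -/
lemma integral_mul_congr_condExp [IsFiniteMeasure P] {m m' : MeasurableSpace Ω} (hm : m ≤ mΩ)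
    {V Y : Ω → ℝ} (hV : AEStronglyMeasurable[m] V P) (hY : Integrable Y P)
    (hVY : Integrable (V * Y) P) (h : P[Y | m] =ᵐ[P] P[Y | m']) :
    ∫ ω, V ω * Y ω ∂P = ∫ ω, V ω * (P[Y | m']) ω ∂P := by
  have h1 := condExp_mul_of_aestronglyMeasurable_left hV hVY hY
  rw [show ∫ ω, V ω * Y ω ∂P = ∫ ω, (V * Y) ω ∂P from rfl, ← integral_condExp hm,
    integral_congr_ae h1]
  refine integral_congr_ae ?_
  filter_upwards [h] with ω hω
  simp [hω]

end CondExp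

/-! ### Complex exponentials and their Taylor remainder -/

/-- The unit complex number `exp (i x)`. -/
noncomputable def cis (x : ℝ) : ℂ := Complex.exp (Complex.I * x)

lemma norm_cis (x : ℝ) : ‖cis x‖ = 1 := Complex.norm_exp_I_mul_ofReal x

lemma cis_add (x y : ℝ) : cis (x + y) = cis x * cis y := by
  simp [cis, mul_add, Complex.exp_add]

@[simp] lemma cis_zero : cis 0 = 1 := by simp [cis]

@[fun_prop] lemma continuous_cis : Continuous cis := by unfold cis; fun_prop

@[fun_prop] lemma measurable_cis : Measurable cis := continuous_cis.measurable

lemma norm_cis_sub_cis_le (x y : ℝ) : ‖cis x - cis y‖ ≤ |x - y| := by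
  have h : cis x - cis y = cis y * (cis (x - y) - 1) := by
    rw [mul_sub, ← cis_add]; simp
  rw [h, norm_mul, norm_cis, one_mul]
  exact Real.norm_exp_I_mul_ofReal_sub_one_le

/-- The second order Taylor remainder of `cis`. -/
noncomputable def cisRem (x : ℝ) : ℂ := cis x - 1 - Complex.I * x + x ^ 2 / 2

@[fun_prop] lemma measurable_cisRem : Measurable cisRem := by
  unfold cisRem; fun_prop

lemma norm_cisRem_le_cube {x : ℝ} (hx : |x| ≤ 1) : ‖cisRem x‖ ≤ |x| ^ 3 := by
  have hn : ‖Complex.I * (x : ℂ)‖ = |x| := by simp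
  have h := Complex.exp_bound (x := Complex.I * x) (by rwa [hn]) (n := 3) (by norm_num)
  rw [hn] at h
  have h2 : cisRem x = Complex.exp (Complex.I * x)
      - ∑ m ∈ Finset.range 3, (Complex.I * (x : ℂ)) ^ m / (m.factorial : ℂ) := by
    simp [Finset.sum_range_succ, cisRem, cis, mul_pow, Nat.factorial]
    ring
  rw [h2]
  refine h.trans ?_
  have : (0 : ℝ) ≤ |x| ^ 3 := by positivity
  norm_num [Nat.factorial]
  linarith

/-- The cubic bound gives smallness near `0`; this one holds everywhere and serves as an integrable
majorant when only second moments exist. -/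
lemma norm_cisRem_le_sq (x : ℝ) : ‖cisRem x‖ ≤ 4 * x ^ 2 := by
  have hsq : x ^ 2 = |x| ^ 2 := (sq_abs x).symm
  have h0 := abs_nonneg x
  rcases le_total |x| 1 with hx | hx
  · refine (norm_cisRem_le_cube hx).trans ?_
    rw [hsq]; nlinarith [sq_nonneg |x|]
  · have h1 : ‖cisRem x‖ ≤ 1 + 1 + |x| + x ^ 2 / 2 := by
      unfold cisRem
      refine (norm_add_le _ _).trans (add_le_add ((norm_sub_le _ _).trans (add_le_add
        ((norm_sub_le _ _).trans ?_) ?_)) ?_)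
      · simp [norm_cis]
      · simp
      · simp
    refine h1.trans ?_
    rw [hsq]; nlinarith

lemma l2_sub_le_of_step {Ω : Type*} {mΩ : MeasurableSpace Ω} {P : Measure Ω}
    {Z : ℕ → Ω → ℝ} (hZ : ∀ n, MemLp (Z n) 2 P) {K : ℝ}
    (hstep : ∀ n, l2 P (Z (n + 1) - Z n) ≤ K) (n r : ℕ) :
    l2 P (Z (n + r) - Z n) ≤ r * K := by
  induction r with
  | zero => simp [l2]
  | succ r ih =>
    have h : Z (n + (r + 1)) - Z n = (Z (n + r + 1) - Z (n + r)) + (Z (n + r) - Z n) := by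
      rw [← add_assoc]; abel
    rw [h]
    refine (l2_add_le ((hZ _).sub (hZ _)) ((hZ _).sub (hZ _))).trans ?_
    push_cast
    linarith [hstep (n + r)]

lemma tendsto_mul_div_div_self {m : ℕ} (hm : 0 < m) :
    Tendsto (fun n : ℕ => ((m * (n / m) : ℕ) : ℝ) / n) atTop (𝓝 1) := by
  have h1 : Tendsto (fun n : ℕ => 1 - (m : ℝ) / n) atTop (𝓝 1) := by
    simpa using (tendsto_const_nhds (x := (1 : ℝ))).sub
      (tendsto_const_div_atTop_nhds_zero_nat (m : ℝ))
  refine tendsto_of_tendsto_of_tendsto_of_le_of_le' h1 tendsto_const_nhds ?_ ?_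
  · filter_upwards [eventually_gt_atTop 0] with n hn
    have hn' : (0 : ℝ) < n := by exact_mod_cast hn
    rw [le_div_iff₀ hn', sub_mul, div_mul_cancel₀ _ hn'.ne', one_mul]
    have := Nat.div_add_mod n m
    have h2 := Nat.mod_lt n hm
    have h3 : n ≤ m * (n / m) + m := by omega
    have h4 : (n : ℝ) ≤ ((m * (n / m) : ℕ) : ℝ) + m := by exact_mod_cast h3
    linarith
  · filter_upwards [eventually_gt_atTop 0] with n hn
    have hn' : (0 : ℝ) < n := by exact_mod_cast hn
    rw [div_le_one hn']
    exact_mod_cast Nat.mul_div_le n m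

/-! ### Comparison of characteristic functions -/

section CharComparison

variable {Ω : Type*} {mΩ : MeasurableSpace Ω} {P : Measure Ω} [IsProbabilityMeasure P]

lemma integrable_cis {Y : Ω → ℝ} (hY : AEStronglyMeasurable Y P) (t : ℝ) :
    Integrable (fun ω => cis (t * Y ω)) P :=
  Integrable.of_bound ((by fun_prop : Continuous fun y : ℝ => cis (t * y)).comp_aestronglyMeasurable
    hY) 1 (ae_of_all _ fun ω => (norm_cis _).le)

lemma norm_integral_cis_sub_le {Y Z : Ω → ℝ} (hY : MemLp Y 2 P) (hZ : MemLp Z 2 P) (t : ℝ) :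
    ‖∫ ω, cis (t * Y ω) ∂P - ∫ ω, cis (t * Z ω) ∂P‖ ≤ |t| * l2 P (Y - Z) := by
  rw [← integral_sub (integrable_cis hY.1 t) (integrable_cis hZ.1 t)]
  refine (norm_integral_le_integral_norm _).trans ?_
  have h1 : ∫ ω, ‖cis (t * Y ω) - cis (t * Z ω)‖ ∂P ≤ ∫ ω, |t| * |(Y - Z) ω| ∂P := by
    refine integral_mono_of_nonneg (ae_of_all _ fun ω => norm_nonneg _)
      (((hY.sub hZ).integrable (by norm_num)).abs.const_mul _) (ae_of_all _ fun ω => ?_)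
    refine (norm_cis_sub_cis_le _ _).trans ?_
    rw [← mul_sub, abs_mul]; rfl
  refine h1.trans ?_
  rw [integral_const_mul]
  exact mul_le_mul_of_nonneg_left (integral_abs_le_l2 (hY.sub hZ)) (abs_nonneg t)

/-- Reduces a limit along all `n` to one along multiples of `m`. Rounding down drops at most `m`
increments of norm at most `K`, negligible against `√n`; the change of normalization costs `L (1 -
√(n'/n))`, with `n'` the rounded value. -/
lemma tendsto_integral_cis_block {Z : ℕ → Ω → ℝ} (hZ : ∀ n, MemLp (Z n) 2 P) {K L : ℝ}
    (hstep : ∀ n, l2 P (Z (n + 1) - Z n) ≤ K) (hL : ∀ n : ℕ, l2 P (Z n) ≤ L * √n)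
    {m : ℕ} (hm : 0 < m) (t : ℝ) :
    Tendsto (fun n : ℕ => ∫ ω, cis (t / √n * Z n ω) ∂P
      - ∫ ω, cis (t / √((m * (n / m) : ℕ) : ℝ) * Z (m * (n / m)) ω) ∂P) atTop (𝓝 0) := by
  have hK : 0 ≤ K := (l2_nonneg _).trans (hstep 0)
  have hbound : Tendsto (fun n : ℕ => |t| * (m * K / √n
      + L * (1 - √(((m * (n / m) : ℕ) : ℝ) / n)))) atTop (𝓝 0) := by
    have h1 : Tendsto (fun n : ℕ => m * K / √(n : ℝ)) atTop (𝓝 0) :=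
      tendsto_const_nhds.div_atTop (Real.tendsto_sqrt_atTop.comp tendsto_natCast_atTop_atTop)
    have h2 := ((Real.continuous_sqrt.tendsto 1).comp (tendsto_mul_div_div_self hm))
    have h3 := (h1.add ((tendsto_const_nhds (x := (1 : ℝ))).sub h2 |>.const_mul L)).const_mul |t|
    simpa using h3
  refine squeeze_zero_norm' ?_ hbound
  filter_upwards [eventually_ge_atTop m] with n hn
  set n' := m * (n / m) with hn'
  have hdm : 0 < n / m := Nat.div_pos hn hm
  have hpos' : 0 < n' := Nat.mul_pos hm hdm
  have hle : n' ≤ n := Nat.mul_div_le n m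
  have hposn : 0 < n := hpos'.trans_le hle
  have hs' : 0 < √(n' : ℝ) := Real.sqrt_pos.2 (by exact_mod_cast hpos')
  have hs : 0 < √(n : ℝ) := Real.sqrt_pos.2 (by exact_mod_cast hposn)
  have hss : √(n' : ℝ) ≤ √(n : ℝ) := Real.sqrt_le_sqrt (by exact_mod_cast hle)
  have e1 : ∀ (k : ℕ) ω, cis (t / √(k : ℝ) * Z k ω) = cis (t * (1 / √(k : ℝ) * Z k ω)) := by
    intro k ω; congr 1; ring
  simp only [e1]
  refine (norm_integral_cis_sub_le ((hZ n).const_mul _) ((hZ n').const_mul _) t).trans ?_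
  refine mul_le_mul_of_nonneg_left ?_ (abs_nonneg t)
  have hdecomp : ((fun ω => 1 / √(n : ℝ) * Z n ω) - fun ω => 1 / √(n' : ℝ) * Z n' ω)
      = (fun ω => 1 / √(n : ℝ) * (Z n - Z n') ω)
        + fun ω => (1 / √(n : ℝ) - 1 / √(n' : ℝ)) * Z n' ω := by
    ext ω; simp; ring
  rw [hdecomp]
  refine (l2_add_le (((hZ n).sub (hZ n')).const_mul _) ((hZ n').const_mul _)).trans ?_
  rw [l2_const_mul, l2_const_mul]
  refine add_le_add ?_ ?_
  · have h5 := l2_sub_le_of_step hZ hstep n' (n - n')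
    rw [Nat.add_sub_cancel' hle] at h5
    have h6 : ((n - n' : ℕ) : ℝ) ≤ m := by
      have := Nat.div_add_mod n m
      have h2 := Nat.mod_lt n hm
      exact_mod_cast (by omega : n - n' ≤ m)
    rw [abs_of_pos (by positivity), div_mul_eq_mul_div, one_mul]
    exact div_le_div_of_nonneg_right (h5.trans (mul_le_mul_of_nonneg_right h6 hK)) hs.le
  · have h7 : |1 / √(n : ℝ) - 1 / √(n' : ℝ)| = 1 / √(n' : ℝ) - 1 / √(n : ℝ) := by
      rw [abs_sub_comm, abs_of_nonneg]
      exact sub_nonneg.2 (one_div_le_one_div_of_le hs' hss)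
    rw [h7, Real.sqrt_div (by positivity)]
    calc (1 / √(n' : ℝ) - 1 / √(n : ℝ)) * l2 P (Z n')
        ≤ (1 / √(n' : ℝ) - 1 / √(n : ℝ)) * (L * √n') :=
          mul_le_mul_of_nonneg_left (hL n') (h7 ▸ abs_nonneg _)
      _ = L * (1 - √(n' : ℝ) / √n) := by field_simp

end CharComparison

/-! ### Identifying conditional expectations on a π-system -/

section PiSystem

variable {Ω : Type*} {m mΩ : MeasurableSpace Ω} {P : Measure Ω} [IsFiniteMeasure P]

/-- The sets on which both integrals agree form a Dynkin system. The whole space is a separate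
hypothesis, as it need not belong to `C`; complements use it. -/
lemma ae_eq_condExp_of_piSystem (hm : m ≤ mΩ) {C : Set (Set Ω)}
    (hgen : m = MeasurableSpace.generateFrom C) (hpi : IsPiSystem C) {Y Z : Ω → ℝ}
    (hY : Integrable Y P) (hZ : Integrable Z P) (hZm : AEStronglyMeasurable[m] Z P)
    (huniv : ∫ ω, Z ω ∂P = ∫ ω, Y ω ∂P)
    (h : ∀ s ∈ C, ∫ ω in s, Z ω ∂P = ∫ ω in s, Y ω ∂P) : Z =ᵐ[P] P[Y | m] := by
  refine ae_eq_condExp_of_forall_setIntegral_eq hm hY (fun s _ _ => hZ.integrableOn) ?_ hZm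
  intro s hs _
  refine MeasurableSpace.induction_on_inter
    (C := fun s _ => ∫ ω in s, Z ω ∂P = ∫ ω in s, Y ω ∂P) hgen hpi (by simp)
    h ?_ ?_ s hs
  · intro t ht iht
    have h1 := integral_add_compl (hm t ht) hZ
    have h2 := integral_add_compl (hm t ht) hY
    linarith
  · intro f hd hf ihf
    have h1 := hasSum_integral_iUnion (fun i => hm _ (hf i)) hd hZ.integrableOn
    have h2 := hasSum_integral_iUnion (fun i => hm _ (hf i)) hd hY.integrableOn
    simp only [ihf] at h1
    exact h1.unique h2

end PiSystem

lemma generateFrom_inter_eq_sup {Ω : Type*} (m₁ m₂ : MeasurableSpace Ω) :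
    m₁ ⊔ m₂ = MeasurableSpace.generateFrom
      {s | ∃ A, MeasurableSet[m₁] A ∧ ∃ B, MeasurableSet[m₂] B ∧ A ∩ B = s} := by
  refine le_antisymm (sup_le ?_ ?_) (MeasurableSpace.generateFrom_le ?_)
  · intro A hA
    exact MeasurableSpace.measurableSet_generateFrom
      ⟨A, hA, Set.univ, @MeasurableSet.univ _ m₂, Set.inter_univ A⟩
  · intro B hB
    exact MeasurableSpace.measurableSet_generateFrom
      ⟨Set.univ, @MeasurableSet.univ _ m₁, B, hB, Set.univ_inter B⟩
  · rintro _ ⟨A, hA, B, hB, rfl⟩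
    exact @MeasurableSet.inter _ (m₁ ⊔ m₂) _ _ ((le_sup_left : m₁ ≤ m₁ ⊔ m₂) _ hA)
      ((le_sup_right : m₂ ≤ m₁ ⊔ m₂) _ hB)

lemma isPiSystem_inter {Ω : Type*} (m₁ m₂ : MeasurableSpace Ω) :
    IsPiSystem {s | ∃ A, MeasurableSet[m₁] A ∧ ∃ B, MeasurableSet[m₂] B ∧ A ∩ B = s} := by
  rintro _ ⟨A, hA, B, hB, rfl⟩ _ ⟨A', hA', B', hB', rfl⟩ -
  exact ⟨A ∩ A', @MeasurableSet.inter _ m₁ _ _ hA hA', B ∩ B',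
    @MeasurableSet.inter _ m₂ _ _ hB hB', Set.inter_inter_inter_comm A A' B B'⟩

lemma ae_eq_condExp_sup {Ω : Type*} {m₁ m₂ mΩ : MeasurableSpace Ω} {P : Measure Ω}
    [IsFiniteMeasure P] (hm₁ : m₁ ≤ mΩ) (hm₂ : m₂ ≤ mΩ) {Y Z : Ω → ℝ}
    (hY : Integrable Y P) (hZ : Integrable Z P) (hZm : AEStronglyMeasurable[m₁ ⊔ m₂] Z P)
    (h : ∀ A, MeasurableSet[m₁] A → ∀ B, MeasurableSet[m₂] B →
      ∫ ω in A ∩ B, Z ω ∂P = ∫ ω in A ∩ B, Y ω ∂P) : Z =ᵐ[P] P[Y | m₁ ⊔ m₂] := by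
  refine ae_eq_condExp_of_piSystem (sup_le hm₁ hm₂) (generateFrom_inter_eq_sup m₁ m₂)
    (isPiSystem_inter m₁ m₂) hY hZ hZm ?_ ?_
  · simpa using h _ (@MeasurableSet.univ _ m₁) _ (@MeasurableSet.univ _ m₂)
  · rintro _ ⟨A, hA, B, hB, rfl⟩
    exact h A hA B hB

section Indicator

variable {Ω : Type*} {mΩ : MeasurableSpace Ω} {P : Measure Ω}

/-- The real valued indicator function of a set. -/
noncomputable abbrev ind (A : Set Ω) : Ω → ℝ := A.indicator fun _ => (1 : ℝ)

lemma memLp_ind [IsFiniteMeasure P] {A : Set Ω} (hA : MeasurableSet A) (p : ℝ≥0∞) :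
    MemLp (ind A) p P :=
  memLp_indicator_const p hA 1 (Or.inr (measure_ne_top P A))

lemma setIntegral_eq_integral_ind_mul {A : Set Ω} (hA : MeasurableSet A) (Y : Ω → ℝ) :
    ∫ ω in A, Y ω ∂P = ∫ ω, ind A ω * Y ω ∂P := by
  rw [← integral_indicator hA]
  congr 1; ext ω
  by_cases h : ω ∈ A <;> simp [ind, h]

lemma aestronglyMeasurable_ind {Ω : Type*} {m mΩ : MeasurableSpace Ω} {P : Measure Ω} {A : Set Ω}
    (hA : MeasurableSet[m] A) : AEStronglyMeasurable[m] (ind A) P :=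
  (stronglyMeasurable_const.indicator hA).aestronglyMeasurable

lemma MemLp.top_mul_integrable {V Y : Ω → ℝ} (hV : MemLp V ⊤ P) (hY : Integrable Y P) :
    Integrable (V * Y) P := by
  rw [← memLp_one_iff_integrable] at hY ⊢
  exact hY.mul hV

end Indicator

/-! ### The Markov property in both time directions -/

section SigmaOn

variable {Ω S : Type*} [MeasurableSpace S]

/-- The sigma-algebra generated by the variables `ξ k`, `k ∈ I`. -/
abbrev sigmaOn (ξ : ℤ → Ω → S) (I : Set ℤ) : MeasurableSpace Ω :=
  ⨆ k ∈ I, MeasurableSpace.comap (ξ k) inferInstance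

variable {ξ : ℤ → Ω → S}

lemma sigmaOn_mono {I J : Set ℤ} (h : I ⊆ J) : sigmaOn ξ I ≤ sigmaOn ξ J :=
  biSup_mono h

lemma present_le_sigmaOn {I : Set ℤ} {k : ℤ} (h : k ∈ I) : present ξ k ≤ sigmaOn ξ I :=
  le_biSup (fun k => MeasurableSpace.comap (ξ k) inferInstance) h

lemma present_le [MeasurableSpace Ω] (hξ : ∀ n, Measurable (ξ n)) (k : ℤ) :
    present ξ k ≤ (inferInstance : MeasurableSpace Ω) := (hξ k).comap_le

lemma sigmaOn_le [MeasurableSpace Ω] (hξ : ∀ n, Measurable (ξ n)) (I : Set ℤ) :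
    sigmaOn ξ I ≤ (inferInstance : MeasurableSpace Ω) :=
  iSup₂_le fun k _ => (hξ k).comap_le

lemma sigmaOn_singleton (n : ℤ) : sigmaOn ξ {n} = present ξ n := by
  simp [sigmaOn]

lemma sigmaOn_union (I J : Set ℤ) : sigmaOn ξ (I ∪ J) = sigmaOn ξ I ⊔ sigmaOn ξ J :=
  iSup_union

lemma sigmaOn_Ici (n : ℤ) : sigmaOn ξ (Set.Ici n) = ⨆ N : ℕ, sigmaOn ξ (Set.Icc n (n + N)) := by
  refine le_antisymm (iSup₂_le fun k hk => ?_)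
    (iSup_le fun N => sigmaOn_mono Set.Icc_subset_Ici_self)
  refine le_trans ?_ (le_iSup _ (k - n).toNat)
  refine present_le_sigmaOn ⟨hk, ?_⟩
  have : n ≤ k := hk
  omega

end SigmaOn

section Markov

variable {Ω S : Type*} [MeasurableSpace Ω] [MeasurableSpace S] {ξ : ℤ → Ω → S}
  {P : Measure Ω} [IsProbabilityMeasure P]


/-- The time-reversed Markov property, by induction on the length of the future window. For an event
`D` of the newest coordinate, the one-step Markov property replaces `ind D` by a function `u` of the
coordinate before it. That function lives on the old window, where the induction hypothesis
exchanges `ind A` for its conditional expectation; then `u` is turned back into `ind D`. -/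
lemma condExp_ind_Icc (hmeas : ∀ n, Measurable (ξ n)) (hmk : HasMarkovProperty P ξ) (n : ℤ)
    {A : Set Ω} (hA : MeasurableSet[past ξ n] A) (N : ℕ) :
    P[ind A | sigmaOn ξ (Set.Icc n (n + N))] =ᵐ[P] P[ind A | present ξ n] := by
  have hA' : MeasurableSet A := sigmaOn_le hmeas _ _ hA
  induction N with
  | zero =>
    have : Set.Icc n (n + (0 : ℕ)) = {n} := by simp
    rw [this, sigmaOn_singleton]
  | succ N ih =>
    have hI : Set.Icc n (n + (N + 1 : ℕ)) = Set.Icc n (n + N) ∪ {n + N + 1} := by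
      ext k; simp only [Set.mem_Icc, Set.mem_union, Set.mem_singleton_iff]; push_cast; omega
    rw [hI, sigmaOn_union, sigmaOn_singleton]
    symm
    set g := P[ind A | present ξ n] with hg
    have hgtop : MemLp g ⊤ P := (memLp_ind hA' ⊤).condExp (by simp)
    have hgm : StronglyMeasurable[present ξ n] g := stronglyMeasurable_condExp
    have hnI : present ξ n ≤ sigmaOn ξ (Set.Icc n (n + N)) := present_le_sigmaOn (by simp)
    refine ae_eq_condExp_sup (sigmaOn_le hmeas _) (present_le hmeas _)
      ((memLp_ind hA' 1).integrable le_rfl) integrable_condExp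
      (hgm.mono (hnI.trans (le_sup_left : _ ≤ sigmaOn ξ (Set.Icc n (n + N)) ⊔
        present ξ (n + N + 1)))).aestronglyMeasurable ?_
    rintro C hC _ ⟨B, hB, rfl⟩
    have hC' : MeasurableSet C := sigmaOn_le hmeas _ _ hC
    set D := ξ (n + N + 1) ⁻¹' B with hD
    have hD' : MeasurableSet D := hmeas _ hB
    set u := P[ind D | present ξ (n + N)] with hu
    have hutop : MemLp u ⊤ P := (memLp_ind hD' ⊤).condExp (by simp)
    have hum : AEStronglyMeasurable[present ξ (n + N)] u P :=
      stronglyMeasurable_condExp.aestronglyMeasurable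
    have hIp : sigmaOn ξ (Set.Icc n (n + N)) ≤ past ξ (n + N) :=
      sigmaOn_mono Set.Icc_subset_Iic_self
    have step : ∀ V : Ω → ℝ, MemLp V ⊤ P → AEStronglyMeasurable[past ξ (n + N)] V P →
        ∫ ω, V ω * ind D ω ∂P = ∫ ω, V ω * u ω ∂P := fun V hV hVm =>
      integral_mul_congr_condExp (sigmaOn_le hmeas _) hVm ((memLp_ind hD' 1).integrable le_rfl)
        (MemLp.top_mul_integrable hV ((memLp_ind hD' 1).integrable le_rfl)) (hmk (n + N) B hB)
    have hCm : AEStronglyMeasurable[sigmaOn ξ (Set.Icc n (n + N))] (ind C) P :=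
      aestronglyMeasurable_ind hC
    have hnN : n ≤ n + N := by omega
    have hAm : AEStronglyMeasurable[past ξ (n + N)] (ind A) P :=
      aestronglyMeasurable_ind (sigmaOn_mono (Set.Iic_subset_Iic.2 hnN) _ hA)
    have e1 := step (ind A * ind C) ((memLp_ind hC' ⊤).mul (memLp_ind hA' ⊤)) (hAm.mul (hCm.mono hIp))
    have e2 := step (g * ind C) ((memLp_ind hC' ⊤).mul hgtop)
      ((hgm.mono (hnI.trans hIp)).aestronglyMeasurable.mul (hCm.mono hIp))
    -- `ind C * u` is measurable on the old window `[n, n + N]`, so `ih` applies.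
    have e3 := integral_mul_congr_condExp (V := ind C * u) (Y := ind A) (sigmaOn_le hmeas _)
      (hCm.mul (hum.mono (present_le_sigmaOn (by simp)))) ((memLp_ind hA' 1).integrable le_rfl)
      (MemLp.top_mul_integrable (hutop.mul (memLp_ind hC' ⊤)) ((memLp_ind hA' 1).integrable le_rfl))
      ih
    have hind : ∀ ω, ind (C ∩ D) ω = ind C ω * ind D ω := fun ω =>
      congrFun (Set.inter_indicator_one (s := C) (t := D) (M₀ := ℝ)) ω
    rw [setIntegral_eq_integral_ind_mul (hC'.inter hD'),
      setIntegral_eq_integral_ind_mul (hC'.inter hD')]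
    simp only [hind, Pi.mul_apply] at e1 e2 e3 ⊢
    calc ∫ ω, ind C ω * ind D ω * g ω ∂P = ∫ ω, g ω * ind C ω * ind D ω ∂P := by
          congr 1; ext ω; ring
      _ = ∫ ω, ind C ω * u ω * g ω ∂P := by rw [e2]; congr 1; ext ω; ring
      _ = ∫ ω, ind A ω * ind C ω * u ω ∂P := by rw [← e3]; congr 1; ext ω; ring
      _ = ∫ ω, ind C ω * ind D ω * ind A ω ∂P := by rw [← e1]; congr 1; ext ω; ring

/-- Events of some finite window form a π-system generating the whole future, so the finite case
suffices. -/
lemma condExp_ind_future (hmeas : ∀ n, Measurable (ξ n)) (hmk : HasMarkovProperty P ξ) (n : ℤ)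
    {A : Set Ω} (hA : MeasurableSet[past ξ n] A) :
    P[ind A | sigmaOn ξ (Set.Ici n)] =ᵐ[P] P[ind A | present ξ n] := by
  have hA' : MeasurableSet A := sigmaOn_le hmeas _ _ hA
  have hAi : Integrable (ind A) P := (memLp_ind hA' 1).integrable le_rfl
  symm
  refine ae_eq_condExp_of_piSystem
    (C := ⋃ N : ℕ, {s | MeasurableSet[sigmaOn ξ (Set.Icc n (n + N))] s}) (sigmaOn_le hmeas _) ?_ ?_
    hAi integrable_condExp
    (stronglyMeasurable_condExp.mono (present_le_sigmaOn (by simp))).aestronglyMeasurable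
    (integral_condExp (present_le hmeas _)) ?_
  · rw [sigmaOn_Ici]
    exact (MeasurableSpace.generateFrom_iUnion_measurableSet
      fun N : ℕ => sigmaOn ξ (Set.Icc n (n + N))).symm
  · refine isPiSystem_iUnion_of_monotone _
      (fun N => @MeasurableSpace.isPiSystem_measurableSet _ (sigmaOn ξ (Set.Icc n (n + N)))) ?_
    intro N M hNM s hs
    refine sigmaOn_mono (Set.Icc_subset_Icc_right ?_) s hs
    have : (N : ℤ) ≤ M := by exact_mod_cast hNM
    omega
  · intro s hs
    obtain ⟨N, hN⟩ := Set.mem_iUnion.1 hs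
    rw [← setIntegral_condExp (sigmaOn_le hmeas _) hAi hN]
    exact setIntegral_congr_ae (sigmaOn_le hmeas _ _ hN)
      ((condExp_ind_Icc hmeas hmk n hA N).mono fun ω h _ => h.symm)

/-- The forward property for the whole future, by duality with the reversed one: both integrals to
be compared equal that of the product of the conditional expectations of `A` and `B` given the
present. -/
lemma condExp_ind_past (hmeas : ∀ n, Measurable (ξ n)) (hmk : HasMarkovProperty P ξ) (n : ℤ)
    {B : Set Ω} (hB : MeasurableSet[sigmaOn ξ (Set.Ici n)] B) :
    P[ind B | past ξ n] =ᵐ[P] P[ind B | present ξ n] := by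
  have hB' : MeasurableSet B := sigmaOn_le hmeas _ _ hB
  have hBi : Integrable (ind B) P := (memLp_ind hB' 1).integrable le_rfl
  symm
  refine ae_eq_condExp_of_forall_setIntegral_eq (sigmaOn_le hmeas _) hBi
    (fun s _ _ => integrable_condExp.integrableOn) ?_
    (stronglyMeasurable_condExp.mono (present_le_sigmaOn (I := Set.Iic n) (by simp))).aestronglyMeasurable
  intro A hA _
  have hA' : MeasurableSet A := sigmaOn_le hmeas _ _ hA
  have hAi : Integrable (ind A) P := (memLp_ind hA' 1).integrable le_rfl
  have hgA : MemLp (P[ind A | present ξ n]) ⊤ P := (memLp_ind hA' ⊤).condExp (by simp)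
  have hgB : MemLp (P[ind B | present ξ n]) ⊤ P := (memLp_ind hB' ⊤).condExp (by simp)
  have e1 := integral_mul_congr_condExp (V := P[ind B | present ξ n]) (Y := ind A)
    (present_le hmeas n) stronglyMeasurable_condExp.aestronglyMeasurable hAi
    (MemLp.top_mul_integrable hgB hAi) (ae_eq_refl _)
  have e2 := integral_mul_congr_condExp (V := ind B) (Y := ind A) (sigmaOn_le hmeas _)
    (aestronglyMeasurable_ind hB) hAi (MemLp.top_mul_integrable (memLp_ind hB' ⊤) hAi)
    (condExp_ind_future hmeas hmk n hA)
  have e3 := integral_mul_congr_condExp (V := P[ind A | present ξ n]) (Y := ind B)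
    (present_le hmeas n) stronglyMeasurable_condExp.aestronglyMeasurable hBi
    (MemLp.top_mul_integrable hgA hBi) (ae_eq_refl _)
  rw [setIntegral_eq_integral_ind_mul hA', setIntegral_eq_integral_ind_mul hA']
  calc ∫ ω, ind A ω * (P[ind B | present ξ n]) ω ∂P
      = ∫ ω, (P[ind B | present ξ n]) ω * ind A ω ∂P := by congr 1; ext ω; ring
    _ = ∫ ω, (P[ind A | present ξ n]) ω * (P[ind B | present ξ n]) ω ∂P := by
        rw [e1]; congr 1; ext ω; ring
    _ = ∫ ω, ind B ω * ind A ω ∂P := by rw [← e3, e2]; congr 1; ext ω; ring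
    _ = ∫ ω, ind A ω * ind B ω ∂P := by congr 1; ext ω; ring

/-- Conditioning a variable of the time interval `[a, b]` on everything outside `(a, b)` amounts
to conditioning it on the two endpoints. -/
theorem condExp_outer (hmeas : ∀ n, Measurable (ξ n)) (hmk : HasMarkovProperty P ξ) {a b : ℤ}
    (hab : a ≤ b) {Y : Ω → ℝ} (hY : Integrable Y P)
    (hYm : AEStronglyMeasurable[sigmaOn ξ (Set.Icc a b)] Y P) :
    P[Y | sigmaOn ξ (Set.Iic a) ⊔ sigmaOn ξ (Set.Ici b)]
      =ᵐ[P] P[Y | present ξ a ⊔ present ξ b] := by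
  have hle : present ξ a ⊔ present ξ b ≤ sigmaOn ξ (Set.Icc a b) :=
    sup_le (present_le_sigmaOn (by simp [hab])) (present_le_sigmaOn (by simp [hab]))
  have hle' := sup_le (present_le hmeas a) (present_le hmeas b)
  symm
  refine ae_eq_condExp_sup (sigmaOn_le hmeas _) (sigmaOn_le hmeas _) hY integrable_condExp
    (stronglyMeasurable_condExp.mono (sup_le_sup (present_le_sigmaOn (by simp))
      (present_le_sigmaOn (by simp)))).aestronglyMeasurable ?_
  intro A hA B hB
  have hA' : MeasurableSet A := sigmaOn_le hmeas _ _ hA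
  have hB' : MeasurableSet B := sigmaOn_le hmeas _ _ hB
  have hAi : Integrable (ind A) P := (memLp_ind hA' 1).integrable le_rfl
  have hBi : Integrable (ind B) P := (memLp_ind hB' 1).integrable le_rfl
  set gA := P[ind A | present ξ a] with hgA
  set gB := P[ind B | present ξ b] with hgB
  have hgAtop : MemLp gA ⊤ P := (memLp_ind hA' ⊤).condExp (by simp)
  have hgBtop : MemLp gB ⊤ P := (memLp_ind hB' ⊤).condExp (by simp)
  have hgAm : AEStronglyMeasurable[present ξ a] gA P :=
    stronglyMeasurable_condExp.aestronglyMeasurable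
  have hgBm : AEStronglyMeasurable[present ξ b] gB P :=
    stronglyMeasurable_condExp.aestronglyMeasurable
  have hind : ∀ ω, ind (A ∩ B) ω = ind A ω * ind B ω := fun ω =>
    congrFun (Set.inter_indicator_one (s := A) (t := B) (M₀ := ℝ)) ω
  -- `ind A * V` lies in the past of `b`, so the forward property turns `ind B` into `gB`; then `gB
  -- * V` lies in the future of `a`, so the reversed property turns `ind A` into `gA`.
  have key : ∀ V : Ω → ℝ, Integrable V P → AEStronglyMeasurable[sigmaOn ξ (Set.Icc a b)] V P →
      ∫ ω in A ∩ B, V ω ∂P = ∫ ω, (gA * gB) ω * V ω ∂P := by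
    intro V hV hVm
    have e1 := integral_mul_congr_condExp (V := ind A * V) (Y := ind B) (sigmaOn_le hmeas _)
      ((aestronglyMeasurable_ind (sigmaOn_mono (Set.Iic_subset_Iic.2 hab) _ hA)).mul
        (hVm.mono (sigmaOn_mono Set.Icc_subset_Iic_self))) hBi
      (by
        rw [mul_comm]
        exact MemLp.top_mul_integrable (memLp_ind hB' ⊤)
          (MemLp.top_mul_integrable (memLp_ind hA' ⊤) hV))
      (condExp_ind_past hmeas hmk b hB)
    have e2 := integral_mul_congr_condExp (V := gB * V) (Y := ind A) (sigmaOn_le hmeas _)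
      ((hgBm.mono (present_le_sigmaOn (by simp [hab]))).mul
        (hVm.mono (sigmaOn_mono Set.Icc_subset_Ici_self))) hAi
      (by
        rw [mul_comm]
        exact MemLp.top_mul_integrable (memLp_ind hA' ⊤) (MemLp.top_mul_integrable hgBtop hV))
      (condExp_ind_future hmeas hmk a hA)
    rw [setIntegral_eq_integral_ind_mul (hA'.inter hB')]
    simp only [hind, Pi.mul_apply] at e1 e2 ⊢
    calc ∫ ω, ind A ω * ind B ω * V ω ∂P = ∫ ω, ind A ω * V ω * ind B ω ∂P := by
          congr 1; ext ω; ring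
      _ = ∫ ω, gB ω * V ω * ind A ω ∂P := by rw [e1]; congr 1; ext ω; ring
      _ = ∫ ω, gA ω * gB ω * V ω ∂P := by rw [e2]; congr 1; ext ω; ring
  -- The weight `gA * gB` depends on the endpoints only, so it does not distinguish `Y` from its
  -- conditional expectation given them.
  rw [key _ integrable_condExp (stronglyMeasurable_condExp.mono hle).aestronglyMeasurable,
    key _ hY hYm]
  symm
  refine integral_mul_congr_condExp hle' ((hgAm.mono le_sup_left).mul (hgBm.mono le_sup_right)) hY
    (MemLp.top_mul_integrable (hgBtop.mul hgAtop) hY) (ae_eq_refl _)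

end Markov

/-! ### Mean ergodic theorems -/

section MeanErgodic

variable {X : Type*} {mX : MeasurableSpace X} {μ : Measure X} {T : X → X}

lemma memLp_birkhoffSum (hT : MeasurePreserving T μ μ) {h : X → ℝ} {p : ℝ≥0∞} (hh : MemLp h p μ)
    (n : ℕ) : MemLp (birkhoffSum T h n) p μ :=
  memLp_finsetSum (μ := μ) (f := fun k x => h (T^[k] x)) (Finset.range n)
    fun k _ => hh.comp_measurePreserving (hT.iterate k)

lemma compMeasurePreserving_iterate_toLp (hT : MeasurePreserving T μ μ) {h : X → ℝ}
    (hh : MemLp h 2 μ) (k : ℕ) : (Lp.compMeasurePreserving T hT)^[k] (hh.toLp h)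
      = (hh.comp_measurePreserving (hT.iterate k)).toLp (h ∘ T^[k]) := by
  induction k with
  | zero => rfl
  | succ k ih =>
    rw [Function.iterate_succ_apply', ih, Lp.toLp_compMeasurePreserving]
    rfl

lemma birkhoffSum_compMeasurePreserving_toLp (hT : MeasurePreserving T μ μ) {h : X → ℝ}
    (hh : MemLp h 2 μ) (n : ℕ) : birkhoffSum (Lp.compMeasurePreserving T hT) id n (hh.toLp h)
      = (memLp_birkhoffSum hT hh n).toLp (birkhoffSum T h n) := by
  induction n with
  | zero =>
    rw [birkhoffSum_zero]
    have h0 : (memLp_birkhoffSum hT hh 0).toLp (birkhoffSum T h 0)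
        = (MemLp.zero : MemLp (0 : X → ℝ) 2 μ).toLp 0 :=
      MemLp.toLp_congr _ _ (ae_of_all _ fun x => birkhoffSum_zero T h x)
    rw [h0, MemLp.toLp_zero]
  | succ n ih =>
    rw [birkhoffSum_succ, ih, id, compMeasurePreserving_iterate_toLp, ← MemLp.toLp_add]
    refine MemLp.toLp_congr _ _ (ae_of_all _ fun x => ?_)
    simp [birkhoffSum_succ]

/-- Von Neumann's theorem for the Koopman operator. Ergodicity makes the invariant vectors constant,
and a centered function is orthogonal to constants, so its projection vanishes. -/
lemma tendsto_l2_birkhoffSum_div [IsProbabilityMeasure μ] (hT : Ergodic T μ) {h : X → ℝ}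
    (hh : MemLp h 2 μ) (h0 : ∫ x, h x ∂μ = 0) :
    Tendsto (fun n : ℕ => l2 μ (birkhoffSum T h n) / n) atTop (𝓝 0) := by
  have hTm := hT.toMeasurePreserving
  let U : Lp ℝ 2 μ →L[ℝ] Lp ℝ 2 μ :=
    (Lp.compMeasurePreservingₗᵢ ℝ T hTm).toContinuousLinearMap
  have hUapp : ∀ g : Lp ℝ 2 μ, U g = Lp.compMeasurePreserving T hTm g := fun g => rfl
  have hlim := ContinuousLinearMap.tendsto_birkhoffAverage_orthogonalProjection U
    (LinearIsometry.norm_toContinuousLinearMap_le _) (hh.toLp h)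
  have hproj : ((U : Lp ℝ 2 μ →ₗ[ℝ] Lp ℝ 2 μ).eqLocus
      ((1 : Lp ℝ 2 μ →L[ℝ] Lp ℝ 2 μ) : Lp ℝ 2 μ →ₗ[ℝ] Lp ℝ 2 μ)).orthogonalProjectionOnto (hh.toLp h)
        = 0 := by
    rw [Submodule.orthogonalProjectionOnto_eq_zero_iff, Submodule.mem_orthogonal]
    intro g hg
    have hg' : U g = g := hg
    have h1 : g ∘ T =ᵐ[μ] g := by
      have := Lp.coeFn_compMeasurePreserving g hTm
      rw [← hUapp, hg'] at this
      exact this.symm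
    obtain ⟨c, hc⟩ := hT.ae_eq_const_of_ae_eq_comp_ae (Lp.aestronglyMeasurable g) h1
    rw [MeasureTheory.L2.inner_def]
    calc ∫ x, inner ℝ (g x) ((hh.toLp h) x) ∂μ = ∫ x, c * h x ∂μ := by
          refine integral_congr_ae ?_
          filter_upwards [hc, hh.coeFn_toLp] with x hx1 hx2
          rw [hx1, hx2]; simp [mul_comm]
      _ = 0 := by rw [integral_const_mul, h0, mul_zero]
  rw [hproj] at hlim
  have hn := hlim.norm
  simp only [ZeroMemClass.coe_zero, norm_zero] at hn
  refine hn.congr fun n => ?_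
  rw [birkhoffAverage, show birkhoffSum U id n (hh.toLp h) = _ from
    birkhoffSum_compMeasurePreserving_toLp hTm hh n, norm_smul, Lp.norm_toLp, l2, norm_inv, Real.norm_natCast]
  ring

lemma integral_abs_birkhoffSum_le [IsFiniteMeasure μ] (hT : MeasurePreserving T μ μ) {h : X → ℝ}
    (hh : Integrable h μ) (n : ℕ) :
    ∫ x, |birkhoffSum T h n x| ∂μ ≤ n * ∫ x, |h x| ∂μ := by
  have hi : ∀ k, Integrable (fun x => |h (T^[k] x)|) μ := fun k =>
    ((hT.iterate k).integrable_comp_of_integrable hh).abs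
  calc ∫ x, |birkhoffSum T h n x| ∂μ ≤ ∫ x, ∑ k ∈ Finset.range n, |h (T^[k] x)| ∂μ :=
        integral_mono_of_nonneg (ae_of_all _ fun x => abs_nonneg _)
          (integrable_finsetSum _ fun k _ => hi k)
          (ae_of_all _ fun x => Finset.abs_sum_le_sum_abs _ _)
    _ = ∑ k ∈ Finset.range n, ∫ x, |h (T^[k] x)| ∂μ := integral_finsetSum _ fun k _ => hi k
    _ = n * ∫ x, |h x| ∂μ := by
        have : ∀ k ∈ Finset.range n, ∫ x, |h (T^[k] x)| ∂μ = ∫ x, |h x| ∂μ := fun k _ =>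
          (hT.iterate k).integral_comp_ae (g := fun x => |h x|) hh.abs.1
        rw [Finset.sum_congr rfl this]; simp

/-- The mean ergodic theorem in `L¹`, for centered functions. -/
theorem tendsto_integral_abs_birkhoffSum_div [IsProbabilityMeasure μ] (hT : Ergodic T μ)
    {h : X → ℝ} (hh : Integrable h μ) (h0 : ∫ x, h x ∂μ = 0) :
    Tendsto (fun n : ℕ => (∫ x, |birkhoffSum T h n x| ∂μ) / n) atTop (𝓝 0) := by
  have hTm := hT.toMeasurePreserving
  rw [Metric.tendsto_atTop]
  intro ε hε
  -- A simple function within `ε/4` of `h`; recentering it costs another `ε/4`. The difference then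
  -- contributes at most `n ε/2` for every `n`, and the `L²` theorem handles the rest.
  obtain ⟨g, hg, hg2⟩ : ∃ g : X → ℝ, eLpNorm (h - g) 1 μ < ENNReal.ofReal (ε / 4)
      ∧ MemLp g 2 μ := by
    obtain ⟨g, hg, -⟩ := (memLp_one_iff_integrable.2 hh).exists_simpleFunc_eLpNorm_sub_lt
      (by simp) (ε := ENNReal.ofReal (ε / 4)) (by simpa using hε)
    exact ⟨g, hg, SimpleFunc.memLp_of_isFiniteMeasure g 2 μ⟩
  have hgi : Integrable g μ := hg2.integrable (by norm_num)
  have hdist : ∫ x, |h x - g x| ∂μ < ε / 4 := by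
    have h1 : ∫ x, |h x - g x| ∂μ = (eLpNorm (h - g) 1 μ).toReal := by
      rw [eLpNorm_one_eq_lintegral_enorm, ← integral_norm_eq_lintegral_enorm (hh.sub hgi).1]
      rfl
    rw [h1]
    exact (ENNReal.lt_ofReal_iff_toReal_lt hg.ne_top).1 hg
  set c := ∫ x, g x ∂μ with hc
  have hcabs : |c| ≤ ∫ x, |h x - g x| ∂μ := by
    have : c = -∫ x, (h x - g x) ∂μ := by rw [integral_sub hh hgi, h0]; simp [hc]
    rw [this, abs_neg]
    exact abs_integral_le_integral_abs
  set k : X → ℝ := fun x => g x - c with hk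
  have hk2 : MemLp k 2 μ := hg2.sub (memLp_const c)
  have hk0 : ∫ x, k x ∂μ = 0 := by
    rw [hk, integral_sub hgi (integrable_const c)]; simp [hc]
  have hki : Integrable k μ := hk2.integrable (by norm_num)
  have hhk : ∫ x, |h x - k x| ∂μ ≤ ε / 2 := by
    calc ∫ x, |h x - k x| ∂μ ≤ ∫ x, (|h x - g x| + |c|) ∂μ := by
          refine integral_mono (hh.sub hki).abs ((hh.sub hgi).abs.add (integrable_const _))
            fun x => ?_
          simp only [hk]
          rw [show h x - (g x - c) = (h x - g x) + c by ring]
          exact abs_add_le _ _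
      _ = ∫ x, |h x - g x| ∂μ + |c| := by
          rw [integral_add (f := fun x => |h x - g x|) (hh.sub hgi).abs (integrable_const _)]; simp
      _ ≤ ε / 2 := by linarith
  have hlim := tendsto_l2_birkhoffSum_div hT hk2 hk0
  obtain ⟨N, hN⟩ := (Metric.tendsto_atTop.1 hlim) (ε / 2) (by linarith)
  refine ⟨max N 1, fun n hn => ?_⟩
  have hn1 : (0 : ℝ) < n := by exact_mod_cast (le_of_max_le_right hn : 1 ≤ n)
  have hNn := hN n (le_of_max_le_left hn)
  rw [Real.dist_eq, sub_zero, abs_of_nonneg (div_nonneg (l2_nonneg _) hn1.le),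
    div_lt_iff₀ hn1] at hNn
  rw [Real.dist_eq, sub_zero, abs_of_nonneg (div_nonneg (integral_nonneg fun x => abs_nonneg _)
    hn1.le), div_lt_iff₀ hn1]
  have hS : ∀ {u : X → ℝ}, Integrable u μ → Integrable (birkhoffSum T u n) μ := fun hu =>
    memLp_one_iff_integrable.1 (memLp_birkhoffSum hTm (memLp_one_iff_integrable.2 hu) n)
  calc ∫ x, |birkhoffSum T h n x| ∂μ
      ≤ ∫ x, (|birkhoffSum T (h - k) n x| + |birkhoffSum T k n x|) ∂μ := by
        refine integral_mono (hS hh).abs ((hS (hh.sub hki)).abs.add (hS hki).abs) fun x => ?_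
        have : birkhoffSum T h n x = birkhoffSum T (h - k) n x + birkhoffSum T k n x := by
          simp [birkhoffSum]
        simp only [this]
        exact abs_add_le _ _
    _ = ∫ x, |birkhoffSum T (h - k) n x| ∂μ + ∫ x, |birkhoffSum T k n x| ∂μ :=
        integral_add (hS (hh.sub hki)).abs (hS hki).abs
    _ ≤ n * (ε / 2) + l2 μ (birkhoffSum T k n) :=
        add_le_add ((integral_abs_birkhoffSum_le hTm (hh.sub hki) n).trans
          (mul_le_mul_of_nonneg_left hhk hn1.le))
          (integral_abs_le_l2 (memLp_birkhoffSum hTm hk2 n))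
    _ < ε * n := by linarith

end MeanErgodic

/-! ### Pythagoras under a bounded complex weight -/

section Orthogonal

variable {Ω : Type*} {mΩ : MeasurableSpace Ω} {P : Measure Ω}

lemma integrable_mul_ofReal {G : Ω → ℂ} (hG : AEStronglyMeasurable G P) (hG1 : ∀ ω, ‖G ω‖ ≤ 1)
    {Z : Ω → ℝ} (hZ : Integrable Z P) : Integrable (fun ω => G ω * (Z ω : ℂ)) P :=
  hZ.ofReal.bdd_mul hG (ae_of_all _ hG1)

lemma integral_mul_sq_sum_of_orthogonal {G : Ω → ℂ} (hG : AEStronglyMeasurable G P)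
    (hG1 : ∀ ω, ‖G ω‖ ≤ 1) {Y : ℕ → Ω → ℝ} (hY : ∀ i, MemLp (Y i) 2 P)
    (horth : ∀ i j, i < j → ∫ ω, G ω * ((Y i ω * Y j ω : ℝ) : ℂ) ∂P = 0) (n : ℕ) :
    ∫ ω, G ω * (((∑ i ∈ Finset.range n, Y i ω) ^ 2 : ℝ) : ℂ) ∂P
      = ∑ i ∈ Finset.range n, ∫ ω, G ω * ((Y i ω ^ 2 : ℝ) : ℂ) ∂P := by
  have hmul : ∀ {U V : Ω → ℝ}, MemLp U 2 P → MemLp V 2 P →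
      Integrable (fun ω => G ω * ((U ω * V ω : ℝ) : ℂ)) P := fun hU hV =>
    integrable_mul_ofReal hG hG1 (hU.integrable_mul hV)
  have hS : ∀ n, MemLp (fun ω => ∑ i ∈ Finset.range n, Y i ω) 2 P := fun n =>
    memLp_finsetSum _ fun i _ => hY i
  induction n with
  | zero => simp
  | succ n ih =>
    rw [Finset.sum_range_succ, ← ih]
    have hcross : ∫ ω, G ω * (((∑ i ∈ Finset.range n, Y i ω) * Y n ω : ℝ) : ℂ) ∂P = 0 := by
      have : ∀ ω, G ω * (((∑ i ∈ Finset.range n, Y i ω) * Y n ω : ℝ) : ℂ)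
          = ∑ i ∈ Finset.range n, G ω * ((Y i ω * Y n ω : ℝ) : ℂ) := fun ω => by
        push_cast; rw [Finset.sum_mul, Finset.mul_sum]
      simp only [this]
      rw [integral_finsetSum _ fun i _ => hmul (hY i) (hY n)]
      exact Finset.sum_eq_zero fun i hi => horth i n (Finset.mem_range.1 hi)
    have hexp : ∀ ω, G ω * (((∑ i ∈ Finset.range (n + 1), Y i ω) ^ 2 : ℝ) : ℂ)
        = (G ω * (((∑ i ∈ Finset.range n, Y i ω) ^ 2 : ℝ) : ℂ)
          + 2 * (G ω * (((∑ i ∈ Finset.range n, Y i ω) * Y n ω : ℝ) : ℂ)))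
          + G ω * ((Y n ω ^ 2 : ℝ) : ℂ) := fun ω => by
      rw [Finset.sum_range_succ]; push_cast; ring
    have i1 : Integrable (fun ω => G ω * (((∑ i ∈ Finset.range n, Y i ω) ^ 2 : ℝ) : ℂ)) P := by
      simpa only [sq] using hmul (hS n) (hS n)
    have i3 : Integrable (fun ω => G ω * ((Y n ω ^ 2 : ℝ) : ℂ)) P := by
      simpa only [sq] using hmul (hY n) (hY n)
    have i2 := (hmul (hS n) (hY n)).const_mul 2
    have i12 : Integrable (fun ω => G ω * (((∑ i ∈ Finset.range n, Y i ω) ^ 2 : ℝ) : ℂ)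
        + 2 * (G ω * (((∑ i ∈ Finset.range n, Y i ω) * Y n ω : ℝ) : ℂ))) P := i1.add i2
    simp only [hexp]
    rw [integral_add i12 i3, integral_add i1 i2, integral_const_mul, hcross]
    simp

lemma integral_sq_sum_of_orthogonal {Y : ℕ → Ω → ℝ} (hY : ∀ i, MemLp (Y i) 2 P)
    (horth : ∀ i j, i < j → ∫ ω, Y i ω * Y j ω ∂P = 0) (n : ℕ) :
    ∫ ω, (∑ i ∈ Finset.range n, Y i ω) ^ 2 ∂P = ∑ i ∈ Finset.range n, ∫ ω, Y i ω ^ 2 ∂P := by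
  have h := integral_mul_sq_sum_of_orthogonal (P := P) (G := fun _ => 1)
    aestronglyMeasurable_const (by simp) hY
    (fun i j hij => by
      simp only [one_mul]
      rw [integral_complex_ofReal, horth i j hij]; simp) n
  simp only [one_mul] at h
  rw [integral_complex_ofReal] at h
  simp only [integral_complex_ofReal] at h
  exact_mod_cast h

end Orthogonal

/-! ### A martingale central limit theorem -/

section MartingaleCLT

variable {X : Type*} {mX : MeasurableSpace X} {μ : Measure X}

/-- Dominated convergence: the quadratic bound gives the majorant `4 u² Y²`, the cubic one gives
pointwise decay of order `1/√k`. -/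
lemma tendsto_mul_integral_norm_cisRem {Y : X → ℝ} (hY : MemLp Y 2 μ) (u : ℝ) :
    Tendsto (fun k : ℕ => (k : ℝ) * ∫ x, ‖cisRem (u / √(k : ℝ) * Y x)‖ ∂μ) atTop (𝓝 0) := by
  have h : Tendsto (fun k : ℕ => ∫ x, (k : ℝ) * ‖cisRem (u / √(k : ℝ) * Y x)‖ ∂μ) atTop
      (𝓝 (∫ _, (0 : ℝ) ∂μ)) := by
    refine tendsto_integral_of_dominated_convergence (fun x => 4 * (u ^ 2 * Y x ^ 2))
      (fun k => ?_) ((hY.integrable_sq.const_mul _).const_mul _) (fun k => ae_of_all _ fun x => ?_)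
      (ae_of_all _ fun x => ?_)
    · exact ((by fun_prop : Measurable fun y : ℝ => (k : ℝ) * ‖cisRem (u / √(k : ℝ) * y)‖).comp_aemeasurable
        hY.1.aemeasurable).aestronglyMeasurable
    · rw [Real.norm_of_nonneg (by positivity)]
      rcases Nat.eq_zero_or_pos k with rfl | hk
      · simp; positivity
      · have hk' : (0 : ℝ) < k := by exact_mod_cast hk
        have := mul_le_mul_of_nonneg_left (norm_cisRem_le_sq (u / √(k : ℝ) * Y x)) hk'.le
        refine this.trans (le_of_eq ?_)
        rw [mul_pow, div_pow, Real.sq_sqrt hk'.le]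
        field_simp
    · have hlim : Tendsto (fun k : ℕ => |u * Y x| ^ 3 / √(k : ℝ)) atTop (𝓝 0) :=
        tendsto_const_nhds.div_atTop (Real.tendsto_sqrt_atTop.comp tendsto_natCast_atTop_atTop)
      have hlim2 : Tendsto (fun k : ℕ => |u * Y x| / √(k : ℝ)) atTop (𝓝 0) :=
        tendsto_const_nhds.div_atTop (Real.tendsto_sqrt_atTop.comp tendsto_natCast_atTop_atTop)
      refine squeeze_zero' (Eventually.of_forall fun k => by positivity) ?_ hlim
      filter_upwards [hlim2.eventually_le_const (zero_lt_one), eventually_gt_atTop 0] with k hk1 hk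
      have hk' : (0 : ℝ) < k := by exact_mod_cast hk
      have hs : 0 < √(k : ℝ) := Real.sqrt_pos.2 hk'
      have habs : |u / √(k : ℝ) * Y x| = |u * Y x| / √(k : ℝ) := by
        rw [div_mul_eq_mul_div, abs_div, abs_of_pos hs]
      have := mul_le_mul_of_nonneg_left (norm_cisRem_le_cube (habs.trans_le hk1)) hk'.le
      refine this.trans (le_of_eq ?_)
      rw [habs, div_pow]
      have h3 : √(k : ℝ) ^ 3 = k * √(k : ℝ) := by rw [pow_succ, Real.sq_sqrt hk'.le]
      rw [h3]
      field_simp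
  simpa [integral_const_mul] using h

variable [IsProbabilityMeasure μ] {T : X → X} {D : X → ℝ}

/-- Expand the exponential of the `p` new terms to second order, against the exponential of the
first `a` terms. The linear part vanishes by `h1`; by `h2` only the diagonal squares survive in the
quadratic part, and they are replaced by their mean. This leaves the factor `1 - τ` with `τ = s² p v
/ 2`, exchanged for `exp (-τ)`. The three errors are ergodic, Taylor and exponential. -/
lemma norm_integral_cis_birkhoffSum_step (hT : MeasurePreserving T μ μ) (hD : MemLp D 2 μ)
    (h1 : ∀ (t : ℝ) (n j : ℕ), n ≤ j →
      ∫ x, cis (t * birkhoffSum T D n x) * (D (T^[j] x) : ℂ) ∂μ = 0)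
    (h2 : ∀ (t : ℝ) (n i j : ℕ), n ≤ i → i < j →
      ∫ x, cis (t * birkhoffSum T D n x) * ((D (T^[i] x) * D (T^[j] x) : ℝ) : ℂ) ∂μ = 0)
    (s : ℝ) (a p : ℕ) :
    ‖∫ x, cis (s * birkhoffSum T D (a + p) x) ∂μ
        - (Real.exp (-(s ^ 2 * (p * ∫ x, D x ^ 2 ∂μ) / 2)) : ℂ)
          * ∫ x, cis (s * birkhoffSum T D a x) ∂μ‖
      ≤ s ^ 2 / 2 * ∫ x, |birkhoffSum T (fun x => D x ^ 2 - ∫ y, D y ^ 2 ∂μ) p x| ∂μ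
        + ∫ x, ‖cisRem (s * birkhoffSum T D p x)‖ ∂μ
        + |Real.exp (-(s ^ 2 * (p * ∫ x, D x ^ 2 ∂μ) / 2)) - 1
            - -(s ^ 2 * (p * ∫ x, D x ^ 2 ∂μ) / 2)| := by
  set v := ∫ x, D x ^ 2 ∂μ with hv
  set τ := s ^ 2 * (p * v) / 2 with hτ
  set G : X → ℂ := fun x => cis (s * birkhoffSum T D a x) with hGdef
  set B : X → ℝ := fun x => birkhoffSum T D p (T^[a] x) with hBdef
  have hDk : ∀ k, MemLp (fun x => D (T^[k] x)) 2 μ := fun k =>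
    hD.comp_measurePreserving (hT.iterate k)
  have hSa := memLp_birkhoffSum hT hD a
  have hSp := memLp_birkhoffSum hT hD p
  have hB : MemLp B 2 μ := hSp.comp_measurePreserving (hT.iterate a)
  have hG : AEStronglyMeasurable G μ := (integrable_cis hSa.1 s).1
  have hG1 : ∀ x, ‖G x‖ ≤ 1 := fun x => (norm_cis _).le
  have hBsum : ∀ x, B x = ∑ l ∈ Finset.range p, D (T^[a + l] x) := fun x => by
    simp only [hBdef, birkhoffSum]
    refine Finset.sum_congr rfl fun l _ => ?_
    rw [add_comm a l, Function.iterate_add_apply]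
  have hrem : Integrable (fun x => cisRem (s * B x)) μ := by
    refine Integrable.mono' (g := fun x => 4 * (s ^ 2 * B x ^ 2))
      ((hB.integrable_sq.const_mul _).const_mul _) ?_ (ae_of_all _ fun x => ?_)
    · exact (by fun_prop : Measurable fun y : ℝ => cisRem (s * y)).comp_aemeasurable
        hB.1.aemeasurable |>.aestronglyMeasurable
    · refine (norm_cisRem_le_sq _).trans (le_of_eq (by ring))
  have hGrem : Integrable (fun x => G x * cisRem (s * B x)) μ :=
    hrem.bdd_mul hG (ae_of_all _ hG1)
  have hGint : Integrable G μ := integrable_cis hSa.1 s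
  have hGB : Integrable (fun x => G x * (B x : ℂ)) μ :=
    integrable_mul_ofReal hG hG1 (hB.integrable (by norm_num))
  have hGB2 : Integrable (fun x => G x * ((B x ^ 2 : ℝ) : ℂ)) μ :=
    integrable_mul_ofReal hG hG1 hB.integrable_sq
  have e1 : ∫ x, G x * (B x : ℂ) ∂μ = 0 := by
    have : ∀ x, G x * (B x : ℂ) = ∑ l ∈ Finset.range p, G x * (D (T^[a + l] x) : ℂ) := fun x => by
      rw [hBsum]; push_cast; rw [Finset.mul_sum]
    simp only [this]
    rw [integral_finsetSum _ fun l _ =>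
      integrable_mul_ofReal hG hG1 ((hDk (a + l)).integrable (by norm_num))]
    exact Finset.sum_eq_zero fun l _ => h1 s a (a + l) (by omega)
  have e2 : ∫ x, G x * ((B x ^ 2 : ℝ) : ℂ) ∂μ
      = ∑ l ∈ Finset.range p, ∫ x, G x * ((D (T^[a + l] x) ^ 2 : ℝ) : ℂ) ∂μ := by
    simp only [hBsum]
    exact integral_mul_sq_sum_of_orthogonal hG hG1 (Y := fun l x => D (T^[a + l] x))
      (fun l => hDk (a + l)) (fun i j hij => h2 s a (a + i) (a + j) (by omega) (by omega)) p
  set H : X → ℝ := fun x => birkhoffSum T (fun x => D x ^ 2 - v) p (T^[a] x) with hHdef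
  have hH0 : Integrable (birkhoffSum T (fun x => D x ^ 2 - v) p) μ :=
    memLp_one_iff_integrable.1 (memLp_birkhoffSum hT (memLp_one_iff_integrable.2
      (hD.integrable_sq.sub (integrable_const v))) p)
  have hH : Integrable H μ := (hT.iterate a).integrable_comp_of_integrable hH0
  have e3 : ∫ x, G x * ((B x ^ 2 : ℝ) : ℂ) ∂μ
      = ∫ x, G x * (H x : ℂ) ∂μ + (p * v : ℝ) * ∫ x, G x ∂μ := by
    rw [e2, ← integral_finsetSum _ fun l _ => integrable_mul_ofReal hG hG1 (hDk (a + l)).integrable_sq,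
      ← integral_const_mul, ← integral_add (integrable_mul_ofReal hG hG1 hH) (hGint.const_mul _)]
    refine integral_congr_ae (ae_of_all _ fun x => ?_)
    have hHsum : H x = ∑ l ∈ Finset.range p, (D (T^[a + l] x) ^ 2 - v) := by
      simp only [hHdef, birkhoffSum]
      refine Finset.sum_congr rfl fun l _ => ?_
      rw [add_comm a l, Function.iterate_add_apply]
    simp only [hHsum, Finset.sum_sub_distrib, ← Finset.mul_sum]
    push_cast
    simp
    ring
  have hexp : ∀ x, cis (s * birkhoffSum T D (a + p) x)
      = ((G x + Complex.I * s * (G x * (B x : ℂ))) - s ^ 2 / 2 * (G x * ((B x ^ 2 : ℝ) : ℂ)))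
        + G x * cisRem (s * B x) := fun x => by
    rw [birkhoffSum_add, mul_add, cis_add]
    change G x * cis (s * B x) = _
    unfold cisRem
    push_cast
    ring
  have e4 : ∫ x, cis (s * birkhoffSum T D (a + p) x) ∂μ - (Real.exp (-τ) : ℂ) * ∫ x, G x ∂μ
      = -(s ^ 2 / 2 * ∫ x, G x * (H x : ℂ) ∂μ) + ∫ x, G x * cisRem (s * B x) ∂μ
        - ((Real.exp (-τ) - 1 - -τ : ℝ) : ℂ) * ∫ x, G x ∂μ := by
    have j1 : Integrable (fun x => G x + Complex.I * s * (G x * (B x : ℂ))) μ :=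
      hGint.add (hGB.const_mul _)
    have j2 : Integrable (fun x => G x + Complex.I * s * (G x * (B x : ℂ))
        - (s : ℂ) ^ 2 / 2 * (G x * ((B x ^ 2 : ℝ) : ℂ))) μ := j1.sub (hGB2.const_mul _)
    simp only [hexp]
    rw [integral_add j2 hGrem, integral_sub j1 (hGB2.const_mul _),
      integral_add hGint (hGB.const_mul _), integral_const_mul, integral_const_mul, e1, e3]
    simp only [hτ]
    push_cast
    ring
  rw [e4]
  refine (norm_sub_le _ _).trans (add_le_add ((norm_add_le _ _).trans (add_le_add ?_ ?_)) ?_)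
  · rw [norm_neg, norm_mul]
    have : ‖(s ^ 2 / 2 : ℂ)‖ = s ^ 2 / 2 := by simp
    rw [this]
    refine mul_le_mul_of_nonneg_left ?_ (by positivity)
    refine (norm_integral_le_integral_norm _).trans ?_
    -- The weight has modulus one and `T^[a]` preserves `μ`, so the error does not depend on `a` and
    -- can be summed over blocks.
    rw [← (hT.iterate a).integral_comp_ae (g := fun x => |birkhoffSum T (fun x => D x ^ 2 - v) p x|)
      hH0.abs.1]
    refine le_of_eq (integral_congr_ae (ae_of_all _ fun x => ?_))
    simp only [norm_mul, hGdef, norm_cis, one_mul, Complex.norm_real, Real.norm_eq_abs, hHdef]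
  · refine (norm_integral_le_integral_norm _).trans ?_
    have hm : AEStronglyMeasurable (fun x => ‖cisRem (s * birkhoffSum T D p x)‖) μ :=
      ((by fun_prop : Measurable fun y : ℝ => cisRem (s * y)).comp_aemeasurable
        hSp.1.aemeasurable).norm.aestronglyMeasurable
    rw [← (hT.iterate a).integral_comp_ae (g := fun x => ‖cisRem (s * birkhoffSum T D p x)‖) hm]
    refine le_of_eq (integral_congr_ae (ae_of_all _ fun x => ?_))
    simp only [norm_mul, hGdef, norm_cis, one_mul, hBdef]
  · rw [norm_mul, Complex.norm_real, Real.norm_eq_abs]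
    refine mul_le_of_le_one_right (abs_nonneg _) ?_
    refine (norm_integral_le_integral_norm _).trans ?_
    simp [hGdef, norm_cis]

/-- Multiplication by `b ≤ 1` does not amplify earlier errors, so they only add up. -/
lemma norm_sub_pow_le_of_step {q : ℕ → ℂ} {b δ : ℝ} (hb0 : 0 ≤ b) (hb1 : b ≤ 1) (h0 : q 0 = 1)
    (hstep : ∀ i, ‖q (i + 1) - (b : ℂ) * q i‖ ≤ δ) (k : ℕ) : ‖q k - (b : ℂ) ^ k‖ ≤ k * δ := by
  induction k with
  | zero => simp [h0]
  | succ k ih =>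
    have : q (k + 1) - (b : ℂ) ^ (k + 1) = (q (k + 1) - b * q k) + b * (q k - (b : ℂ) ^ k) := by
      ring
    rw [this]
    refine (norm_add_le _ _).trans ?_
    rw [norm_mul, Complex.norm_real, Real.norm_of_nonneg hb0]
    have := mul_le_mul hb1 ih (norm_nonneg _) zero_le_one
    push_cast
    linarith [hstep k]

/-- The central limit theorem for the Birkhoff sums of a square integrable function along an
ergodic transformation, under a martingale difference condition. -/
theorem tendsto_integral_cis_birkhoffSum (hT : Ergodic T μ) (hD : MemLp D 2 μ)
    (h1 : ∀ (t : ℝ) (n j : ℕ), n ≤ j →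
      ∫ x, cis (t * birkhoffSum T D n x) * (D (T^[j] x) : ℂ) ∂μ = 0)
    (h2 : ∀ (t : ℝ) (n i j : ℕ), n ≤ i → i < j →
      ∫ x, cis (t * birkhoffSum T D n x) * ((D (T^[i] x) * D (T^[j] x) : ℝ) : ℂ) ∂μ = 0)
    (t : ℝ) :
    Tendsto (fun n : ℕ => ∫ x, cis (t / √(n : ℝ) * birkhoffSum T D n x) ∂μ) atTop
      (𝓝 (Real.exp (-(t ^ 2 * (∫ x, D x ^ 2 ∂μ) / 2)) : ℂ)) := by
  have hTm := hT.toMeasurePreserving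
  set v := ∫ x, D x ^ 2 ∂μ with hv
  have hv0 : 0 ≤ v := integral_nonneg fun x => sq_nonneg _
  set c := t ^ 2 * v / 2 with hc
  have hc0 : 0 ≤ c := by positivity
  set H : X → ℝ := fun x => D x ^ 2 - v with hH
  have hHi : Integrable H μ := hD.integrable_sq.sub (integrable_const v)
  have hH0 : ∫ x, H x ∂μ = 0 := by
    rw [hH, integral_sub hD.integrable_sq (integrable_const v)]; simp [hv]
  have hDk : ∀ k, MemLp (fun x => D (T^[k] x)) 2 μ := fun k =>
    hD.comp_measurePreserving (hTm.iterate k)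
  have hsq : ∀ k, ∫ x, D (T^[k] x) ^ 2 ∂μ = v := fun k =>
    (hTm.iterate k).integral_comp_ae (g := fun x => D x ^ 2) hD.integrable_sq.1
  have hvar : ∀ n : ℕ, l2 μ (birkhoffSum T D n) ≤ √v * √(n : ℝ) := by
    intro n
    rw [l2_eq_sqrt (memLp_birkhoffSum hTm hD n), ← Real.sqrt_mul hv0]
    refine Real.sqrt_le_sqrt (le_of_eq ?_)
    have := integral_sq_sum_of_orthogonal (P := μ) (Y := fun k x => D (T^[k] x)) hDk
      (fun i j hij => by
        -- At `t = 0` the weight is `1`, leaving plain orthogonality.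
        have := h2 0 0 i j (Nat.zero_le _) hij
        simp only [zero_mul, cis_zero, one_mul] at this
        rw [integral_complex_ofReal] at this
        exact_mod_cast this) n
    simp only [birkhoffSum]
    rw [this]
    simp [hsq, mul_comm]
  have hstep : ∀ n : ℕ, l2 μ (birkhoffSum T D (n + 1) - birkhoffSum T D n) ≤ l2 μ D := by
    intro n
    have : birkhoffSum T D (n + 1) - birkhoffSum T D n = D ∘ T^[n] := by
      ext x; simp [birkhoffSum_succ]
    rw [this, l2_comp (hTm.iterate n) hD.1]
  -- With `k` blocks of length `p` and `s = t/√(pk)`, each step has `τ = c/k`, so the product of the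
  -- factors is exactly `exp (-c)`. The `k` ergodic errors carry the total coefficient `k s²/2 =
  -- t²/(2p)`.
  have hblock : ∀ p : ℕ, 0 < p → ∀ k : ℕ, 0 < k →
      ‖∫ x, cis (t / √((p * k : ℕ) : ℝ) * birkhoffSum T D (p * k) x) ∂μ - (Real.exp (-c) : ℂ)‖
        ≤ t ^ 2 / 2 * ((∫ x, |birkhoffSum T H p x| ∂μ) / p)
          + (k * ∫ x, ‖cisRem (t / √(p : ℝ) / √(k : ℝ) * birkhoffSum T D p x)‖ ∂μ
          + k * |Real.exp (-(c / k)) - 1 - -(c / k)|) := by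
    intro p hp k hk
    have hp' : (0 : ℝ) < p := by exact_mod_cast hp
    have hk' : (0 : ℝ) < k := by exact_mod_cast hk
    set s := t / √((p * k : ℕ) : ℝ) with hs
    have hs' : s = t / √(p : ℝ) / √(k : ℝ) := by
      rw [hs]; push_cast; rw [Real.sqrt_mul hp'.le, div_div]
    have hs2 : s ^ 2 = t ^ 2 / (p * k) := by
      rw [hs, div_pow, Real.sq_sqrt (by positivity)]; push_cast; rfl
    have hτ : s ^ 2 * (p * v) / 2 = c / k := by
      rw [hs2, hc]; field_simp
    have hone := norm_sub_pow_le_of_step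
      (q := fun i => ∫ x, cis (s * birkhoffSum T D (p * i) x) ∂μ)
      (b := Real.exp (-(c / k))) (Real.exp_pos _).le
      (Real.exp_le_one_iff.2 (neg_nonpos.2 (by positivity))) (by simp)
      (fun i => by
        have := norm_integral_cis_birkhoffSum_step hTm hD h1 h2 s (p * i) p
        rw [← hv, hτ] at this
        exact this) k
    have hpow : ((Real.exp (-(c / k)) : ℝ) : ℂ) ^ k = (Real.exp (-c) : ℂ) := by
      rw [← Complex.ofReal_pow, ← Real.exp_nat_mul]
      congr 2
      field_simp
    rw [hpow] at hone
    refine hone.trans (le_of_eq ?_)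
    rw [← hs', hs2]
    field_simp
    ring
  have hε := (tendsto_integral_abs_birkhoffSum_div hT hHi hH0).const_mul (t ^ 2 / 2)
  rw [mul_zero] at hε
  have hρ : Tendsto (fun k : ℕ => (k : ℝ) * |Real.exp (-(c / k)) - 1 - -(c / k)|) atTop (𝓝 0) := by
    have hl1 : Tendsto (fun k : ℕ => c ^ 2 / (k : ℝ)) atTop (𝓝 0) :=
      tendsto_const_div_atTop_nhds_zero_nat _
    refine squeeze_zero' (Eventually.of_forall fun k => by positivity) ?_ hl1
    filter_upwards [(tendsto_const_div_atTop_nhds_zero_nat c).eventually_le_const zero_lt_one,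
      eventually_gt_atTop 0] with k hk1 hk
    have hk' : (0 : ℝ) < k := by exact_mod_cast hk
    have := Real.abs_exp_sub_one_sub_id_le (x := -(c / k))
      (by rw [abs_neg, abs_of_nonneg (by positivity)]; exact hk1)
    refine (mul_le_mul_of_nonneg_left this hk'.le).trans (le_of_eq ?_)
    field_simp
  rw [Metric.tendsto_atTop]
  intro ε hεpos
  -- `p` is fixed first, to make the ergodic error small; the other errors vanish as the number `n /
  -- p` of blocks grows.
  obtain ⟨p, hp0, hp⟩ := ((eventually_gt_atTop 0).and
    (hε.eventually_lt_const (show (0 : ℝ) < ε / 3 by linarith))).exists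
  have hη : Tendsto (fun k : ℕ =>
      (k : ℝ) * ∫ x, ‖cisRem (t / √(p : ℝ) / √(k : ℝ) * birkhoffSum T D p x)‖ ∂μ
          + k * |Real.exp (-(c / k)) - 1 - -(c / k)|) atTop (𝓝 0) := by
    simpa using (tendsto_mul_integral_norm_cisRem (memLp_birkhoffSum hTm hD p)
      (t / √(p : ℝ))).add hρ
  have hη' := (hη.comp (Nat.tendsto_div_const_atTop hp0.ne')).eventually_lt_const
    (show (0 : ℝ) < ε / 3 by linarith)
  have hcmp := (tendsto_integral_cis_block (P := μ) (fun n => memLp_birkhoffSum hTm hD n) hstep hvar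
    hp0 t).norm.eventually_lt_const (show ‖(0 : ℂ)‖ < ε / 3 by simpa using hεpos)
  obtain ⟨N, hN⟩ := eventually_atTop.1 ((hη'.and hcmp).and (eventually_ge_atTop p))
  refine ⟨N, fun n hn => ?_⟩
  obtain ⟨⟨ha, hb⟩, hc'⟩ := hN n hn
  have hd := hblock p hp0 (n / p) (Nat.div_pos hc' hp0)
  simp only [Function.comp_apply] at ha
  rw [dist_eq_norm]
  refine (norm_sub_le_norm_sub_add_norm_sub _
    (∫ x, cis (t / √((p * (n / p) : ℕ) : ℝ) * birkhoffSum T D (p * (n / p)) x) ∂μ) _).trans_lt ?_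
  linarith

end MartingaleCLT

/-! ### Passing to the path space -/

section PathSpace

variable {Ω S : Type*} [MeasurableSpace Ω] [MeasurableSpace S]

/-- The coordinate process on the space of two-sided sequences. -/
def coord (n : ℤ) (x : ℤ → S) : S := x n

/-- The path of the process, seen from time `k`. -/
def pathMap (ξ : ℤ → Ω → S) (k : ℕ) (ω : Ω) : ℤ → S := fun n => ξ (n + k) ω

lemma shift_iterate_apply (k : ℕ) (x : ℤ → S) (n : ℤ) : shift^[k] x n = x (n + k) := by
  induction k generalizing x with
  | zero => simp
  | succ k ih =>
    rw [Function.iterate_succ_apply, ih, shift]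
    push_cast
    congr 1
    ring

lemma measurable_coord (n : ℤ) : Measurable (coord n : (ℤ → S) → S) := measurable_pi_apply n

lemma shift_iterate_pathMap (ξ : ℤ → Ω → S) (k j : ℕ) (ω : Ω) :
    shift^[j] (pathMap ξ k ω) = pathMap ξ (k + j) ω := by
  ext n
  rw [shift_iterate_apply, pathMap, pathMap]
  push_cast
  congr 1
  ring

variable {ξ : ℤ → Ω → S} {P : Measure Ω}

lemma IsStationaryMarkovChain.measurePreserving_shift (hξ : IsStationaryMarkovChain P ξ) :
    MeasurePreserving shift (pathLaw P ξ) (pathLaw P ξ) :=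
  ⟨measurable_pi_lambda _ fun n => measurable_pi_apply (n + 1), hξ.stationary⟩

lemma IsStationaryMarkovChain.measurePreserving_pathMap (hξ : IsStationaryMarkovChain P ξ)
    (k : ℕ) : MeasurePreserving (pathMap ξ k) P (pathLaw P ξ) := by
  have h0 : MeasurePreserving (fun ω n => ξ n ω) P (pathLaw P ξ) :=
    ⟨measurable_pi_lambda _ hξ.measurable, rfl⟩
  have h1 := (hξ.measurePreserving_shift.iterate k).comp h0
  have h2 : shift^[k] ∘ (fun ω n => ξ n ω) = pathMap ξ k := by
    ext ω n
    simp [shift_iterate_apply, pathMap]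
  rwa [h2] at h1

lemma IsStationaryMarkovChain.isProbabilityMeasure_pathLaw [IsProbabilityMeasure P]
    (hξ : IsStationaryMarkovChain P ξ) : IsProbabilityMeasure (pathLaw P ξ) :=
  Measure.isProbabilityMeasure_map (measurable_pi_lambda _ hξ.measurable).aemeasurable

lemma comap_pathMap_present (k : ℕ) (a : ℤ) :
    (present (coord : ℤ → (ℤ → S) → S) a).comap (pathMap ξ k) = present ξ (a + k) := by
  rw [present, MeasurableSpace.comap_comp]
  rfl

lemma comap_pathMap_pair (k : ℕ) (a b : ℤ) :
    (present (coord : ℤ → (ℤ → S) → S) a ⊔ present coord b).comap (pathMap ξ k)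
      = present ξ (a + k) ⊔ present ξ (b + k) := by
  rw [MeasurableSpace.comap_sup, comap_pathMap_present, comap_pathMap_present]

/-- By stationarity, block quantities need to be defined only once, at time `0` on the path space;
this recovers them for the block starting at time `k`. -/
lemma condPair_comp_pathMap [IsProbabilityMeasure P] (hξ : IsStationaryMarkovChain P ξ)
    (k : ℕ) (a b : ℤ) {g : (ℤ → S) → ℝ} (hg : Integrable g (pathLaw P ξ)) :
    condPair (pathLaw P ξ) coord a b g ∘ pathMap ξ k
      =ᵐ[P] condPair P ξ (a + k) (b + k) (g ∘ pathMap ξ k) := by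
  have := hξ.isProbabilityMeasure_pathLaw
  have h := condExp_comp (hξ.measurePreserving_pathMap k)
    (sup_le (present_le measurable_coord a) (present_le measurable_coord b)) hg
  rw [comap_pathMap_pair] at h
  exact h

lemma partialSum_eq_birkhoffSum (f : S → ℝ) (n : ℕ) :
    partialSum f (coord : ℤ → (ℤ → S) → S) n = birkhoffSum shift (fun x => f (x 1)) n := by
  ext x
  induction n with
  | zero => simp [partialSum]
  | succ n ih =>
    rw [birkhoffSum_succ, ← ih, partialSum, partialSum, Finset.sum_Icc_succ_top (by omega),
      shift_iterate_apply, coord]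
    push_cast
    rw [add_comm (1 : ℤ)]

lemma partialSum_comp_pathMap (f : S → ℝ) (n k : ℕ) (ω : Ω) :
    partialSum f coord n (pathMap ξ k ω) = ∑ i ∈ Finset.Icc 1 n, f (ξ ((i : ℤ) + k) ω) := rfl

lemma partialSum_comp_pathMap_zero (f : S → ℝ) (n : ℕ) :
    partialSum f coord n ∘ pathMap ξ 0 = partialSum f ξ n := by
  ext ω
  simp [partialSum, coord, pathMap]

lemma IsStationaryMarkovChain.memLp_coord (hξ : IsStationaryMarkovChain P ξ)
    {f : S → ℝ} (hf2 : MemLp f 2 (P.map (ξ 0))) (k : ℕ) :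
    MemLp (fun x : ℤ → S => f (x k)) 2 (pathLaw P ξ) := by
  have h0 : MeasurePreserving (coord 0) (pathLaw P ξ) (P.map (ξ 0)) := by
    refine ⟨measurable_coord 0, ?_⟩
    rw [pathLaw, Measure.map_map (measurable_coord 0) (measurable_pi_lambda _ hξ.measurable)]
    rfl
  have h1 := (hf2.comp_measurePreserving h0).comp_measurePreserving
    (hξ.measurePreserving_shift.iterate k)
  have h2 : (f ∘ coord 0) ∘ shift^[k] = fun x : ℤ → S => f (x k) := by
    ext x
    simp [shift_iterate_apply, coord]
  rwa [h2] at h1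

lemma IsStationaryMarkovChain.memLp_partialSum (hξ : IsStationaryMarkovChain P ξ)
    {f : S → ℝ} (hf2 : MemLp f 2 (P.map (ξ 0))) (n : ℕ) :
    MemLp (partialSum f coord n) 2 (pathLaw P ξ) :=
  memLp_finsetSum (Finset.Icc 1 n) fun k _ => hξ.memLp_coord hf2 k

end PathSpace

/-! ### Block means, block noises and their orthogonality -/

section Blocks

variable {Ω S : Type*} [MeasurableSpace Ω] [MeasurableSpace S]

/-- The conditional mean of the sum over a block given the chain at both ends of the block. -/
noncomputable def blockMean (P : Measure Ω) (ξ : ℤ → Ω → S) (f : S → ℝ) (m : ℕ) :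
    (ℤ → S) → ℝ :=
  condPair (pathLaw P ξ) coord 0 m (partialSum f coord m)

/-- The sum over a block, centered at its conditional mean given both ends of the block. -/
noncomputable def blockNoise (P : Measure Ω) (ξ : ℤ → Ω → S) (f : S → ℝ) (m : ℕ) :
    (ℤ → S) → ℝ :=
  fun x => partialSum f coord m x - blockMean P ξ f m x

variable {ξ : ℤ → Ω → S} {P : Measure Ω} [IsProbabilityMeasure P] {f : S → ℝ}

lemma sigmaOn_le_outer {I : Set ℤ} {a b : ℤ} (h : I ⊆ Set.Iic a ∪ Set.Ici b) :
    sigmaOn ξ I ≤ sigmaOn ξ (Set.Iic a) ⊔ sigmaOn ξ (Set.Ici b) :=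
  (sigmaOn_mono h).trans (sigmaOn_union _ _).le

lemma stronglyMeasurable_blockMean_comp (m k : ℕ) :
    StronglyMeasurable[sigmaOn ξ {(k : ℤ), (m : ℤ) + k}]
      (fun ω => blockMean P ξ f m (pathMap ξ k ω)) := by
  have h : StronglyMeasurable[present (coord : ℤ → (ℤ → S) → S) 0 ⊔ present coord m]
      (blockMean P ξ f m) := stronglyMeasurable_condExp
  have h2 : StronglyMeasurable[(present (coord : ℤ → (ℤ → S) → S) 0 ⊔ present coord m).comap
      (pathMap ξ k)] (fun ω => blockMean P ξ f m (pathMap ξ k ω)) :=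
    h.comp_measurable (comap_measurable _)
  rw [comap_pathMap_pair] at h2
  refine h2.mono (sup_le ?_ ?_)
  · rw [zero_add]; exact present_le_sigmaOn (by simp)
  · exact present_le_sigmaOn (by simp)

lemma stronglyMeasurable_partialSum_comp (hf : Measurable f) (m k : ℕ) :
    StronglyMeasurable[sigmaOn ξ (Set.Icc (k : ℤ) (m + k))]
      (fun ω => partialSum f coord m (pathMap ξ k ω)) := by
  simp only [partialSum_comp_pathMap]
  refine Finset.stronglyMeasurable_fun_sum _ fun i hi => ?_
  have hi' := Finset.mem_Icc.1 hi
  have : present ξ ((i : ℤ) + k) ≤ sigmaOn ξ (Set.Icc (k : ℤ) (m + k)) :=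
    present_le_sigmaOn ⟨by omega, by omega⟩
  refine (Measurable.stronglyMeasurable ?_).mono this
  exact hf.comp (comap_measurable _)

lemma stronglyMeasurable_blockNoise_comp (hf : Measurable f) (m k : ℕ) :
    StronglyMeasurable[sigmaOn ξ (Set.Icc (k : ℤ) (m + k))]
      (fun ω => blockNoise P ξ f m (pathMap ξ k ω)) := by
  refine (stronglyMeasurable_partialSum_comp hf m k).sub
    ((stronglyMeasurable_blockMean_comp m k).mono (sigmaOn_mono ?_))
  intro i hi
  rcases hi with rfl | rfl <;> simp

lemma memLp_blockMean (hξ : IsStationaryMarkovChain P ξ)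
    (hf2 : MemLp f 2 (P.map (ξ 0))) (m : ℕ) : MemLp (blockMean P ξ f m) 2 (pathLaw P ξ) :=
  (hξ.memLp_partialSum hf2 m).condExp (by norm_num)

lemma memLp_blockNoise (hξ : IsStationaryMarkovChain P ξ)
    (hf2 : MemLp f 2 (P.map (ξ 0))) (m : ℕ) : MemLp (blockNoise P ξ f m) 2 (pathLaw P ξ) :=
  (hξ.memLp_partialSum hf2 m).sub (memLp_blockMean hξ hf2 m)

/-- By `condExp_outer` the noise is also the residual of the projection onto the whole exterior of
the block, the source of all orthogonality below. -/
lemma blockNoise_comp_pathMap_ae (hξ : IsStationaryMarkovChain P ξ) (hf : Measurable f)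
    (hf2 : MemLp f 2 (P.map (ξ 0))) (m k : ℕ) :
    (fun ω => blockNoise P ξ f m (pathMap ξ k ω)) =ᵐ[P] fun ω =>
      partialSum f coord m (pathMap ξ k ω) - (P[fun ω => partialSum f coord m (pathMap ξ k ω) |
        sigmaOn ξ (Set.Iic (k : ℤ)) ⊔ sigmaOn ξ (Set.Ici ((m : ℤ) + k))]) ω := by
  have := hξ.isProbabilityMeasure_pathLaw
  have hS := hξ.memLp_partialSum hf2 m
  have h1 := condPair_comp_pathMap hξ k 0 m (hS.integrable (by norm_num))
  have h2 := condExp_outer (P := P) hξ.measurable hξ.markov (a := k) (b := m + k) (by omega)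
    ((hS.comp_measurePreserving (hξ.measurePreserving_pathMap k)).integrable (by norm_num))
    (stronglyMeasurable_partialSum_comp hf m k).aestronglyMeasurable
  filter_upwards [h1, h2] with ω h1 h2
  have h3 : blockMean P ξ f m (pathMap ξ k ω) = _ := h1
  rw [blockNoise, h3]
  congr 1
  rw [zero_add]
  exact h2.symm

lemma integral_mul_blockNoise_eq_zero {𝕜 : Type*} [RCLike 𝕜] (hξ : IsStationaryMarkovChain P ξ)
    (hf : Measurable f) (hf2 : MemLp f 2 (P.map (ξ 0))) (m k : ℕ) {G : Ω → 𝕜}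
    (hG : AEStronglyMeasurable[sigmaOn ξ (Set.Iic (k : ℤ)) ⊔ sigmaOn ξ (Set.Ici ((m : ℤ) + k))] G P)
    (hG2 : MemLp G 2 P) :
    ∫ ω, G ω * ((blockNoise P ξ f m (pathMap ξ k ω) : ℝ) : 𝕜) ∂P = 0 := by
  rw [← integral_mul_sub_condExp_eq_zero (sup_le (sigmaOn_le hξ.measurable _)
    (sigmaOn_le hξ.measurable _)) hG hG2 ((hξ.memLp_partialSum hf2 m).comp_measurePreserving
      (hξ.measurePreserving_pathMap k))]
  refine integral_congr_ae ?_
  filter_upwards [blockNoise_comp_pathMap_ae hξ hf hf2 m k] with ω hω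
  rw [hω]
  rfl

lemma integral_mul_blockNoise_eq_zero_real (hξ : IsStationaryMarkovChain P ξ)
    (hf : Measurable f) (hf2 : MemLp f 2 (P.map (ξ 0))) (m k : ℕ) {I : Set ℤ}
    (hI : I ⊆ Set.Iic (k : ℤ) ∪ Set.Ici ((m : ℤ) + k)) {G : Ω → ℝ}
    (hG : AEStronglyMeasurable[sigmaOn ξ I] G P) (hG2 : MemLp G 2 P) :
    ∫ ω, G ω * blockNoise P ξ f m (pathMap ξ k ω) ∂P = 0 := by
  simpa using integral_mul_blockNoise_eq_zero (𝕜 := ℝ) hξ hf hf2 m k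
    (hG.mono (sigmaOn_le_outer hI)) hG2

lemma integral_sq_add_of_orthogonal {U V : Ω → ℝ} (hU : MemLp U 2 P) (hV : MemLp V 2 P)
    (h : ∫ ω, U ω * V ω ∂P = 0) :
    ∫ ω, (U ω + V ω) ^ 2 ∂P = ∫ ω, U ω ^ 2 ∂P + ∫ ω, V ω ^ 2 ∂P := by
  have i1 : Integrable (fun ω => U ω * V ω) P := hU.integrable_mul hV
  have i2 : Integrable (fun ω => U ω ^ 2 + 2 * (U ω * V ω)) P :=
    hU.integrable_sq.add (i1.const_mul 2)
  have e : ∀ ω, (U ω + V ω) ^ 2 = U ω ^ 2 + 2 * (U ω * V ω) + V ω ^ 2 := fun ω => by ring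
  simp only [e]
  rw [integral_add i2 hV.integrable_sq, integral_add hU.integrable_sq (i1.const_mul 2),
    integral_const_mul, h]
  ring

/-- The variance of the noise of a block is superadditive in the length of the block. -/
lemma blockNoise_superadditive (hξ : IsStationaryMarkovChain P ξ)
    (hf : Measurable f) (hf2 : MemLp f 2 (P.map (ξ 0))) (m n : ℕ) :
    ∫ x, blockNoise P ξ f m x ^ 2 ∂(pathLaw P ξ) + ∫ x, blockNoise P ξ f n x ^ 2 ∂(pathLaw P ξ)
      ≤ ∫ x, blockNoise P ξ f (m + n) x ^ 2 ∂(pathLaw P ξ) := by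
  have hφ := hξ.measurePreserving_pathMap
  have hN : ∀ m k, MemLp (fun ω => blockNoise P ξ f m (pathMap ξ k ω)) 2 P := fun m k =>
    (memLp_blockNoise hξ hf2 m).comp_measurePreserving (hφ k)
  have hM : ∀ m k, MemLp (fun ω => blockMean P ξ f m (pathMap ξ k ω)) 2 P := fun m k =>
    (memLp_blockMean hξ hf2 m).comp_measurePreserving (hφ k)
  have htr : ∀ m k, ∫ x, blockNoise P ξ f m x ^ 2 ∂(pathLaw P ξ)
      = ∫ ω, blockNoise P ξ f m (pathMap ξ k ω) ^ 2 ∂P := fun m k =>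
    ((hφ k).integral_comp_ae (g := fun x => blockNoise P ξ f m x ^ 2)
      (memLp_blockNoise hξ hf2 m).integrable_sq.1).symm
  rw [htr m 0, htr n m, htr (m + n) 0]
  set A := fun ω => blockNoise P ξ f m (pathMap ξ 0 ω) with hA
  set B := fun ω => blockNoise P ξ f n (pathMap ξ m ω) with hB
  -- The discrepancy of the means depends only on times `0`, `m`, `m + n`, none of them interior to
  -- either short block. Hence the long noise is an orthogonal sum of `R`, `B` and `A`, and dropping
  -- `R` gives the inequality.
  set R : Ω → ℝ := fun ω => blockMean P ξ f m (pathMap ξ 0 ω) + blockMean P ξ f n (pathMap ξ m ω)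
    - blockMean P ξ f (m + n) (pathMap ξ 0 ω) with hR
  have hdec : ∀ ω, blockNoise P ξ f (m + n) (pathMap ξ 0 ω) = (R ω + B ω) + A ω := by
    intro ω
    have : partialSum f coord (m + n) (pathMap ξ 0 ω)
        = partialSum f coord m (pathMap ξ 0 ω) + partialSum f coord n (pathMap ξ m ω) := by
      simp only [partialSum_eq_birkhoffSum]
      rw [birkhoffSum_add, shift_iterate_pathMap, zero_add]
    simp only [hR, hA, hB, blockNoise, this]
    ring
  have hRL : MemLp R 2 P := ((hM m 0).add (hM n m)).sub (hM (m + n) 0)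
  have hRm : AEStronglyMeasurable[sigmaOn ξ {0, (m : ℤ), (m : ℤ) + n}] R P := by
    refine StronglyMeasurable.aestronglyMeasurable ?_
    refine ((StronglyMeasurable.mono (stronglyMeasurable_blockMean_comp m 0) ?_).add
      (StronglyMeasurable.mono (stronglyMeasurable_blockMean_comp n m) ?_)).sub
      (StronglyMeasurable.mono (stronglyMeasurable_blockMean_comp (m + n) 0) ?_)
    · refine sigmaOn_mono ?_
      rintro i (rfl | rfl) <;> simp
    · refine sigmaOn_mono ?_
      rintro i (rfl | rfl) <;> simp [add_comm]
    · refine sigmaOn_mono ?_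
      rintro i (rfl | rfl) <;> simp
  have hRB : ∫ ω, R ω * B ω ∂P = 0 := by
    refine integral_mul_blockNoise_eq_zero_real hξ hf hf2 n m ?_ hRm hRL
    rintro i (rfl | rfl | rfl)
    · left; simp
    · left; simp
    · right; simp [add_comm]
  have hRBA : ∫ ω, (R ω + B ω) * A ω ∂P = 0 := by
    refine integral_mul_blockNoise_eq_zero_real hξ hf hf2 m 0
      (I := {0, (m : ℤ), (m : ℤ) + n} ∪ Set.Icc (m : ℤ) (n + m)) ?_
      ((hRm.mono (sigmaOn_mono Set.subset_union_left)).add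
        ((stronglyMeasurable_blockNoise_comp hf n m).mono
          (sigmaOn_mono Set.subset_union_right)).aestronglyMeasurable) (hRL.add (hN n m))
    rintro i ((rfl | rfl | rfl) | hi)
    · left; simp
    · right; simp
    · right; simp
    · right; simpa using hi.1
  have e1 := integral_sq_add_of_orthogonal (hRL.add (hN n m)) (hN m 0) hRBA
  have e2 := integral_sq_add_of_orthogonal hRL (hN n m) hRB
  simp only [hdec]
  simp only [Pi.add_apply] at e1
  have h0 : 0 ≤ ∫ ω, R ω ^ 2 ∂P := integral_nonneg fun ω => sq_nonneg _
  calc _ ≤ ∫ ω, (R ω + B ω) ^ 2 ∂P + ∫ ω, A ω ^ 2 ∂P := by rw [e2]; linarith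
    _ = _ := e1.symm

lemma integral_sq_partialSum (hξ : IsStationaryMarkovChain P ξ)
    (hf2 : MemLp f 2 (P.map (ξ 0))) (n : ℕ) :
    ∫ x, partialSum f coord n x ^ 2 ∂(pathLaw P ξ)
      = ∫ x, blockNoise P ξ f n x ^ 2 ∂(pathLaw P ξ) + l2 (pathLaw P ξ) (blockMean P ξ f n) ^ 2 := by
  have := hξ.isProbabilityMeasure_pathLaw
  have hM := memLp_blockMean hξ hf2 n
  rw [l2_sq hM, add_comm, ← integral_sq_add_of_orthogonal hM (memLp_blockNoise hξ hf2 n)]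
  · simp [blockNoise]
  · have hle := sup_le (present_le (ξ := (coord : ℤ → (ℤ → S) → S)) measurable_coord 0)
      (present_le measurable_coord n)
    have hMm : StronglyMeasurable[present (coord : ℤ → (ℤ → S) → S) 0 ⊔ present coord n]
      (blockMean P ξ f n) := stronglyMeasurable_condExp
    exact integral_mul_sub_condExp_eq_zero (𝕜 := ℝ) hle hMm.aestronglyMeasurable hM
      (hξ.memLp_partialSum hf2 n)

lemma iterate_shift_iterate_pathMap (m j : ℕ) (ω : Ω) :
    (shift^[m])^[j] (pathMap ξ 0 ω) = pathMap ξ (m * j) ω := by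
  rw [← Function.iterate_mul, shift_iterate_pathMap, zero_add]

lemma integral_pathLaw (hξ : IsStationaryMarkovChain P ξ) {E : Type*} [NormedAddCommGroup E]
    [NormedSpace ℝ E] {g : (ℤ → S) → E} (hg : AEStronglyMeasurable g (pathLaw P ξ)) :
    ∫ x, g x ∂(pathLaw P ξ) = ∫ ω, g (pathMap ξ 0 ω) ∂P :=
  ((hξ.measurePreserving_pathMap 0).integral_comp_ae hg).symm

lemma memLp_pathMap (hξ : IsStationaryMarkovChain P ξ) {g : (ℤ → S) → ℝ}
    (hg : MemLp g 2 (pathLaw P ξ)) (k : ℕ) : MemLp (fun ω => g (pathMap ξ k ω)) 2 P :=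
  hg.comp_measurePreserving (hξ.measurePreserving_pathMap k)

/-- All block ends are multiples of `m`, and no multiple of `m` is interior to block `j`. The case
`i = j` is included. -/
lemma integral_blockMean_mul_blockNoise (hξ : IsStationaryMarkovChain P ξ)
    (hf : Measurable f) (hf2 : MemLp f 2 (P.map (ξ 0))) (m i j : ℕ) :
    ∫ x, blockMean P ξ f m ((shift^[m])^[i] x) * blockNoise P ξ f m ((shift^[m])^[j] x)
      ∂(pathLaw P ξ) = 0 := by
  have hT := hξ.measurePreserving_shift.iterate m
  refine (integral_pathLaw hξ ?_).trans ?_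
  · exact ((memLp_blockMean hξ hf2 m).comp_measurePreserving (hT.iterate i)).1.mul
      ((memLp_blockNoise hξ hf2 m).comp_measurePreserving (hT.iterate j)).1
  simp only [iterate_shift_iterate_pathMap]
  refine integral_mul_blockNoise_eq_zero_real hξ hf hf2 m (m * j) ?_
    (stronglyMeasurable_blockMean_comp m (m * i)).aestronglyMeasurable
    (memLp_pathMap hξ (memLp_blockMean hξ hf2 m) _)
  have key : ∀ l : ℕ, ((m * l : ℕ) : ℤ) ∈ Set.Iic ((m * j : ℕ) : ℤ)
      ∪ Set.Ici ((m : ℤ) + (m * j : ℕ)) := by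
    intro l
    rcases Nat.lt_or_ge j l with h | h
    · right
      have : m * (j + 1) ≤ m * l := Nat.mul_le_mul_left m h
      rw [mul_add, mul_one] at this
      simp only [Set.mem_Ici]
      exact_mod_cast (by omega : m + m * j ≤ m * l)
    · left
      simp only [Set.mem_Iic]
      exact_mod_cast Nat.mul_le_mul_left m h
  rintro l (rfl | rfl)
  · exact key i
  · have := key (i + 1)
    rwa [mul_add, mul_one, Nat.cast_add, add_comm (((m * i : ℕ) : ℤ))] at this

lemma stronglyMeasurable_birkhoffSum_blockNoise_comp (hf : Measurable f) (m n : ℕ) :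
    StronglyMeasurable[sigmaOn ξ (Set.Iic ((m * n : ℕ) : ℤ))]
      (fun ω => birkhoffSum (shift^[m]) (blockNoise P ξ f m) n (pathMap ξ 0 ω)) := by
  simp only [birkhoffSum, iterate_shift_iterate_pathMap]
  refine Finset.stronglyMeasurable_fun_sum _ fun i hi => ?_
  refine (stronglyMeasurable_blockNoise_comp hf m (m * i)).mono (sigmaOn_mono ?_)
  intro l hl
  have h1 : m * (i + 1) ≤ m * n := Nat.mul_le_mul_left m (Finset.mem_range.1 hi)
  rw [mul_add, mul_one] at h1
  have h2 : ((m * i : ℕ) : ℤ) + m ≤ ((m * n : ℕ) : ℤ) := by exact_mod_cast h1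
  have h3 := hl.2
  simp only [Set.mem_Iic]
  omega

/-- The first `n` blocks end no later than block `j` starts, so the exponential is measurable
outside block `j`. This supplies the linear hypothesis of the martingale limit theorem. -/
lemma integral_cis_mul_blockNoise (hξ : IsStationaryMarkovChain P ξ)
    (hf : Measurable f) (hf2 : MemLp f 2 (P.map (ξ 0))) (m : ℕ) (t : ℝ) {n j : ℕ} (hnj : n ≤ j) :
    ∫ x, cis (t * birkhoffSum (shift^[m]) (blockNoise P ξ f m) n x)
      * (blockNoise P ξ f m ((shift^[m])^[j] x) : ℂ) ∂(pathLaw P ξ) = 0 := by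
  have := hξ.isProbabilityMeasure_pathLaw
  have hT := hξ.measurePreserving_shift.iterate m
  have hN := memLp_blockNoise hξ hf2 m
  refine (integral_pathLaw hξ ?_).trans ?_
  · exact (integrable_cis (memLp_birkhoffSum hT hN n).1 t).1.mul
      (hN.comp_measurePreserving (hT.iterate j)).ofReal.1
  simp only [iterate_shift_iterate_pathMap]
  have hGm : StronglyMeasurable[sigmaOn ξ (Set.Iic ((m * n : ℕ) : ℤ))]
      (fun ω => cis (t * birkhoffSum (shift^[m]) (blockNoise P ξ f m) n (pathMap ξ 0 ω))) :=
    (by fun_prop : Continuous fun y : ℝ => cis (t * y)).comp_stronglyMeasurable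
      (stronglyMeasurable_birkhoffSum_blockNoise_comp hf m n)
  have hout : sigmaOn ξ (Set.Iic ((m * j : ℕ) : ℤ)) ≤ sigmaOn ξ (Set.Iic ((m * j : ℕ) : ℤ))
      ⊔ sigmaOn ξ (Set.Ici ((m : ℤ) + (m * j : ℕ))) := le_sup_left
  refine integral_mul_blockNoise_eq_zero hξ hf hf2 m (m * j)
    (hGm.mono ((sigmaOn_mono ?_).trans hout)).aestronglyMeasurable
    (MemLp.of_bound (hGm.mono (sigmaOn_le hξ.measurable _)).aestronglyMeasurable 1
      (ae_of_all _ fun ω => (norm_cis _).le))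
  exact Set.Iic_subset_Iic.2 (by exact_mod_cast Nat.mul_le_mul_left m hnj)

/-- Block `i` also ends before block `j` starts, so its noise can join the weight; the product is
square integrable because the exponential has modulus one. -/
lemma integral_cis_mul_blockNoise_mul (hξ : IsStationaryMarkovChain P ξ)
    (hf : Measurable f) (hf2 : MemLp f 2 (P.map (ξ 0))) (m : ℕ) (t : ℝ) {n i j : ℕ} (hni : n ≤ i)
    (hij : i < j) :
    ∫ x, cis (t * birkhoffSum (shift^[m]) (blockNoise P ξ f m) n x)
      * ((blockNoise P ξ f m ((shift^[m])^[i] x) * blockNoise P ξ f m ((shift^[m])^[j] x) : ℝ) : ℂ)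
        ∂(pathLaw P ξ) = 0 := by
  have := hξ.isProbabilityMeasure_pathLaw
  have hT := hξ.measurePreserving_shift.iterate m
  have hN := memLp_blockNoise hξ hf2 m
  have hNk := fun k => hN.comp_measurePreserving (hT.iterate k)
  refine (integral_pathLaw hξ ?_).trans ?_
  · exact (integrable_cis (memLp_birkhoffSum hT hN n).1 t).1.mul
      (Complex.continuous_ofReal.comp_aestronglyMeasurable ((hNk i).1.mul (hNk j).1))
  simp only [iterate_shift_iterate_pathMap, Complex.ofReal_mul, ← mul_assoc]
  have hle : ∀ {a b : ℕ}, a ≤ b → sigmaOn ξ (Set.Iic ((m * a : ℕ) : ℤ))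
      ≤ sigmaOn ξ (Set.Iic ((m * b : ℕ) : ℤ)) := fun h =>
    sigmaOn_mono (Set.Iic_subset_Iic.2 (by exact_mod_cast Nat.mul_le_mul_left m h))
  have hDm : StronglyMeasurable[sigmaOn ξ (Set.Iic ((m * j : ℕ) : ℤ))]
      (fun ω => blockNoise P ξ f m (pathMap ξ (m * i) ω)) := by
    refine (stronglyMeasurable_blockNoise_comp hf m (m * i)).mono (sigmaOn_mono ?_)
    intro l hl
    have h1 : m * (i + 1) ≤ m * j := Nat.mul_le_mul_left m hij
    rw [mul_add, mul_one] at h1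
    have h2 : ((m * i : ℕ) : ℤ) + m ≤ ((m * j : ℕ) : ℤ) := by exact_mod_cast h1
    have h3 := hl.2
    simp only [Set.mem_Iic]
    omega
  have hGm : StronglyMeasurable[sigmaOn ξ (Set.Iic ((m * j : ℕ) : ℤ))]
      (fun ω => cis (t * birkhoffSum (shift^[m]) (blockNoise P ξ f m) n (pathMap ξ 0 ω))
        * (blockNoise P ξ f m (pathMap ξ (m * i) ω) : ℂ)) :=
    ((by fun_prop : Continuous fun y : ℝ => cis (t * y)).comp_stronglyMeasurable
      ((stronglyMeasurable_birkhoffSum_blockNoise_comp hf m n).mono (hle (by omega)))).mul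
      (Complex.continuous_ofReal.comp_stronglyMeasurable hDm)
  have hout : sigmaOn ξ (Set.Iic ((m * j : ℕ) : ℤ)) ≤ sigmaOn ξ (Set.Iic ((m * j : ℕ) : ℤ))
      ⊔ sigmaOn ξ (Set.Ici ((m : ℤ) + (m * j : ℕ))) := le_sup_left
  refine integral_mul_blockNoise_eq_zero hξ hf hf2 m (m * j)
    (hGm.mono hout).aestronglyMeasurable ?_
  refine (memLp_pathMap hξ hN (m * i)).mono
    (hGm.mono (sigmaOn_le hξ.measurable _)).aestronglyMeasurable (ae_of_all _ fun ω => ?_)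
  rw [norm_mul, norm_cis, one_mul, Complex.norm_real]

lemma integral_blockNoise_mul_blockNoise (hξ : IsStationaryMarkovChain P ξ)
    (hf : Measurable f) (hf2 : MemLp f 2 (P.map (ξ 0))) (m : ℕ) {i j : ℕ} (hij : i < j) :
    ∫ x, blockNoise P ξ f m ((shift^[m])^[i] x) * blockNoise P ξ f m ((shift^[m])^[j] x)
      ∂(pathLaw P ξ) = 0 := by
  have h := integral_cis_mul_blockNoise_mul hξ hf hf2 m 0 (Nat.zero_le i) hij
  simp only [zero_mul, cis_zero, one_mul] at h
  rw [integral_complex_ofReal] at h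
  exact_mod_cast h

lemma partialSum_mul_eq_birkhoffSum (m k : ℕ) :
    partialSum f coord (m * k) = birkhoffSum (shift^[m]) (blockNoise P ξ f m) k
      + birkhoffSum (shift^[m]) (blockMean P ξ f m) k := by
  have h : partialSum f (coord : ℤ → (ℤ → S) → S) (m * k)
      = birkhoffSum (shift^[m]) (partialSum f coord m) k := by
    ext x
    simp only [partialSum_eq_birkhoffSum]
    induction k with
    | zero => simp
    | succ k ih => rw [mul_add, mul_one, birkhoffSum_add, ih, birkhoffSum_succ, Function.iterate_mul]
  rw [h]
  ext x
  simp [birkhoffSum, blockNoise]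

/-- The distance of the partial sum to the sum of the noises of the blocks. -/
lemma l2_sq_birkhoffSum_blockMean (hξ : IsStationaryMarkovChain P ξ)
    (hf : Measurable f) (hf2 : MemLp f 2 (P.map (ξ 0))) (m k : ℕ) :
    l2 (pathLaw P ξ) (birkhoffSum (shift^[m]) (blockMean P ξ f m) k) ^ 2
      = ∫ x, partialSum f coord (m * k) x ^ 2 ∂(pathLaw P ξ)
        - k * ∫ x, blockNoise P ξ f m x ^ 2 ∂(pathLaw P ξ) := by
  have := hξ.isProbabilityMeasure_pathLaw
  have hT := hξ.measurePreserving_shift.iterate m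
  have hN := memLp_blockNoise hξ hf2 m
  have hM := memLp_blockMean hξ hf2 m
  have hNk := fun k => hN.comp_measurePreserving (hT.iterate k)
  have hMk := fun k => hM.comp_measurePreserving (hT.iterate k)
  have hNs := memLp_birkhoffSum hT hN k
  have hMs := memLp_birkhoffSum hT hM k
  -- Only noises against means: the means may be correlated with one another, and the norm of their
  -- sum is read off as a difference.
  have horth : ∫ x, birkhoffSum (shift^[m]) (blockNoise P ξ f m) k x
      * birkhoffSum (shift^[m]) (blockMean P ξ f m) k x ∂(pathLaw P ξ) = 0 := by
    simp only [birkhoffSum, Finset.sum_mul_sum]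
    have hint : ∀ i j, Integrable (fun x => blockNoise P ξ f m ((shift^[m])^[i] x)
        * blockMean P ξ f m ((shift^[m])^[j] x)) (pathLaw P ξ) := fun i j =>
      (hNk i).integrable_mul (hMk j)
    rw [integral_finsetSum _ fun i _ => integrable_finsetSum _ fun j _ => hint i j]
    refine Finset.sum_eq_zero fun i _ => ?_
    rw [integral_finsetSum _ fun j _ => hint i j]
    refine Finset.sum_eq_zero fun j _ => ?_
    rw [← integral_blockMean_mul_blockNoise hξ hf hf2 m j i]
    simp only [mul_comm]
  have e1 := integral_sq_add_of_orthogonal hNs hMs horth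
  have e2 := integral_sq_sum_of_orthogonal (P := pathLaw P ξ)
    (Y := fun i x => blockNoise P ξ f m ((shift^[m])^[i] x)) hNk
    (fun i j hij => integral_blockNoise_mul_blockNoise hξ hf hf2 m hij) k
  have e3 : ∀ i, ∫ x, blockNoise P ξ f m ((shift^[m])^[i] x) ^ 2 ∂(pathLaw P ξ)
      = ∫ x, blockNoise P ξ f m x ^ 2 ∂(pathLaw P ξ) := fun i =>
    (hT.iterate i).integral_comp_ae (g := fun x => blockNoise P ξ f m x ^ 2) hN.integrable_sq.1
  simp only [e3, Finset.sum_const, Finset.card_range, nsmul_eq_mul] at e2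
  rw [l2_sq hMs, partialSum_mul_eq_birkhoffSum (P := P) (ξ := ξ)]
  simp only [Pi.add_apply]
  rw [e1, ← e2]
  simp [birkhoffSum]

end Blocks

/-! ### Sums of order `o(√n)` -/

lemma sqrt_le_sum_one_div_sqrt (n : ℕ) :
    √(n : ℝ) ≤ ∑ i ∈ Finset.range n, 1 / √((i : ℝ) + 1) := by
  induction n with
  | zero => simp
  | succ n ih =>
    rw [Finset.sum_range_succ]
    push_cast
    have hs : 0 < √((n : ℝ) + 1) := Real.sqrt_pos.2 (by positivity)
    have h0 : √(n : ℝ) * √(n : ℝ) = n := Real.mul_self_sqrt (by positivity)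
    have h1 : √((n : ℝ) + 1) * √((n : ℝ) + 1) = n + 1 := Real.mul_self_sqrt (by positivity)
    have hle : √(n : ℝ) ≤ √((n : ℝ) + 1) := Real.sqrt_le_sqrt (by linarith)
    have : √((n : ℝ) + 1) - √(n : ℝ) ≤ 1 / √((n : ℝ) + 1) := by
      rw [le_div_iff₀ hs]
      nlinarith [Real.sqrt_nonneg (n : ℝ)]
    linarith

lemma sum_one_div_sqrt_le (n : ℕ) :
    ∑ i ∈ Finset.range n, 1 / √((i : ℝ) + 1) ≤ 2 * √(n : ℝ) := by
  induction n with
  | zero => simp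
  | succ n ih =>
    rw [Finset.sum_range_succ]
    push_cast
    have hs : 0 < √((n : ℝ) + 1) := Real.sqrt_pos.2 (by positivity)
    have h0 : √(n : ℝ) * √(n : ℝ) = n := Real.mul_self_sqrt (by positivity)
    have h1 : √((n : ℝ) + 1) * √((n : ℝ) + 1) = n + 1 := Real.mul_self_sqrt (by positivity)
    have : 1 / √((n : ℝ) + 1) ≤ 2 * (√((n : ℝ) + 1) - √(n : ℝ)) := by
      rw [div_le_iff₀ hs]
      nlinarith [sq_nonneg (√((n : ℝ) + 1) - √(n : ℝ))]
    linarith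

/-- The hypothesis says `w n = o(1/√(n+1))`. The comparison series diverges and its partial sums are
of order `√n`, so the little-o passes to the sums. -/
lemma tendsto_sum_div_sqrt {w : ℕ → ℝ}
    (h : Tendsto (fun n : ℕ => (n : ℝ) * w n ^ 2) atTop (𝓝 0)) :
    Tendsto (fun n : ℕ => (∑ i ∈ Finset.range n, w i) / √(n : ℝ)) atTop (𝓝 0) := by
  have hw : w =o[atTop] fun i : ℕ => 1 / √((i : ℝ) + 1) := by
    refine Asymptotics.isLittleO_of_tendsto' (Eventually.of_forall fun i hi => ?_) ?_
    · have : 0 < 1 / √((i : ℝ) + 1) := by positivity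
      exact absurd hi this.ne'
    · have h2 : Tendsto (fun n : ℕ => √(2 * ((n : ℝ) * w n ^ 2))) atTop (𝓝 0) := by
        simpa using ((h.const_mul 2).sqrt)
      refine squeeze_zero_norm' ?_ h2
      filter_upwards [eventually_ge_atTop 1] with n hn
      have hn' : (1 : ℝ) ≤ n := by exact_mod_cast hn
      rw [div_div_eq_mul_div, div_one, norm_mul, Real.norm_eq_abs, Real.norm_eq_abs,
        abs_of_nonneg (Real.sqrt_nonneg _), ← Real.sqrt_sq_eq_abs,
        ← Real.sqrt_mul (sq_nonneg _)]
      refine Real.sqrt_le_sqrt ?_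
      nlinarith [sq_nonneg (w n)]
  have hs := hw.sum_range (fun i => by positivity)
    (tendsto_atTop_mono sqrt_le_sum_one_div_sqrt
      (Real.tendsto_sqrt_atTop.comp tendsto_natCast_atTop_atTop))
  have hO : (fun n : ℕ => ∑ i ∈ Finset.range n, 1 / √((i : ℝ) + 1)) =O[atTop]
      fun n : ℕ => √(n : ℝ) := by
    refine Asymptotics.IsBigO.of_bound 2 (Eventually.of_forall fun n => ?_)
    rw [Real.norm_of_nonneg (Finset.sum_nonneg fun i _ => by positivity),
      Real.norm_of_nonneg (Real.sqrt_nonneg _)]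
    exact sum_one_div_sqrt_le n
  exact (hs.trans_isBigO hO).tendsto_div_nhds_zero

/-! ### Asymptotic variance and the limit of characteristic functions -/

section Limits

variable {Ω S : Type*} [MeasurableSpace Ω] [MeasurableSpace S]
  {ξ : ℤ → Ω → S} {P : Measure Ω} [IsProbabilityMeasure P] {f : S → ℝ}

/-- The window of radius `j` around `i` lies inside `[0, n]`, so the exterior of `(0, n)` carries
less information than the exterior of that window. Conditional expectation contracts the norm, and
stationarity moves `i` to `0`. -/
lemma l2_condPair_le (hξ : IsStationaryMarkovChain P ξ) (hf : Measurable f)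
    (hf2 : MemLp f 2 (P.map (ξ 0))) {i j n : ℕ} (hji : j ≤ i) (hijn : i + j ≤ n) :
    l2 P (condPair P ξ 0 n fun ω => f (ξ i ω))
      ≤ l2 (pathLaw P ξ) (condPair (pathLaw P ξ) coord (-(j : ℤ)) j fun x => f (x 0)) := by
  have := hξ.isProbabilityMeasure_pathLaw
  have hφ := hξ.measurePreserving_pathMap i
  have hX : MemLp (fun x : ℤ → S => f (x 0)) 2 (pathLaw P ξ) := hξ.memLp_coord hf2 0
  have hXi := hX.integrable (by norm_num : (1 : ℝ≥0∞) ≤ 2)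
  set Y : Ω → ℝ := fun ω => f (ξ i ω) with hYdef
  have hYX : (fun x : ℤ → S => f (x 0)) ∘ pathMap ξ i = Y := by
    ext ω; simp [pathMap, hYdef]
  have hY : MemLp Y 2 P := hYX ▸ hX.comp_measurePreserving hφ
  have hYi := hY.integrable (by norm_num : (1 : ℝ≥0∞) ≤ 2)
  have hYm : ∀ a b : ℤ, a ≤ i → i ≤ b → AEStronglyMeasurable[sigmaOn ξ (Set.Icc a b)] Y P :=
    fun a b ha hb => ((hf.comp (comap_measurable (ξ i))).stronglyMeasurable.mono
      (present_le_sigmaOn (I := Set.Icc a b) (k := (i : ℤ)) ⟨ha, hb⟩)).aestronglyMeasurable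
  have h1 := condExp_outer hξ.measurable hξ.markov (a := 0) (b := n) (by omega) hYi
    (hYm 0 n (by omega) (by omega))
  have h2 := condExp_outer hξ.measurable hξ.markov (a := -(j : ℤ) + i) (b := (j : ℤ) + i)
    (by omega) hYi (hYm _ _ (by omega) (by omega))
  have hle : sigmaOn ξ (Set.Iic (0 : ℤ)) ⊔ sigmaOn ξ (Set.Ici (n : ℤ))
      ≤ sigmaOn ξ (Set.Iic (-(j : ℤ) + i)) ⊔ sigmaOn ξ (Set.Ici ((j : ℤ) + i)) :=
    sup_le_sup (sigmaOn_mono (Set.Iic_subset_Iic.2 (by omega)))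
      (sigmaOn_mono (Set.Ici_subset_Ici.2 (by omega)))
  have h3 := condExp_condExp_of_le (μ := P) (f := Y) hle
    (sup_le (sigmaOn_le hξ.measurable _) (sigmaOn_le hξ.measurable _))
  have h4 := condPair_comp_pathMap hξ i (-(j : ℤ)) j hXi
  rw [hYX] at h4
  have hcm : AEStronglyMeasurable (condPair (pathLaw P ξ) coord (-(j : ℤ)) j
      fun x => f (x 0)) (pathLaw P ξ) := integrable_condExp.1
  rw [← l2_comp hφ hcm, l2_congr h4]
  calc l2 P (condPair P ξ 0 n Y)
      = l2 P (P[P[Y | sigmaOn ξ (Set.Iic (-(j : ℤ) + i)) ⊔ sigmaOn ξ (Set.Ici ((j : ℤ) + i))] |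
          sigmaOn ξ (Set.Iic (0 : ℤ)) ⊔ sigmaOn ξ (Set.Ici (n : ℤ))]) :=
        l2_congr (h1.symm.trans h3.symm)
    _ ≤ l2 P (P[Y | sigmaOn ξ (Set.Iic (-(j : ℤ) + i)) ⊔ sigmaOn ξ (Set.Ici ((j : ℤ) + i))]) :=
        l2_condExp_le (hY.condExp (by norm_num))
    _ = _ := l2_congr h2

/-- Each term uses the distance to its nearest end, the smaller of `i` and `n - i`. Adding the
bounds for both ends avoids the minimum, and reflecting the sum gives the factor `2`. -/
lemma l2_blockMean_le (hξ : IsStationaryMarkovChain P ξ) (hf : Measurable f)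
    (hf2 : MemLp f 2 (P.map (ξ 0))) (n : ℕ) :
    l2 (pathLaw P ξ) (blockMean P ξ f n) ≤ 2 * ∑ j ∈ Finset.range (n + 1),
      l2 (pathLaw P ξ) (condPair (pathLaw P ξ) coord (-(j : ℤ)) j fun x => f (x 0)) := by
  have := hξ.isProbabilityMeasure_pathLaw
  set w : ℕ → ℝ := fun j =>
    l2 (pathLaw P ξ) (condPair (pathLaw P ξ) coord (-(j : ℤ)) j fun x => f (x 0)) with hw
  have hw0 : ∀ j, 0 ≤ w j := fun j => l2_nonneg _
  have hφ := hξ.measurePreserving_pathMap 0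
  have hF := hξ.memLp_partialSum hf2 n
  have hY : ∀ i : ℕ, MemLp (fun ω => f (ξ i ω)) 2 P := by
    intro i
    have := (hξ.memLp_coord hf2 i).comp_measurePreserving hφ
    simpa [Function.comp_def, pathMap] using this
  have h1 := condPair_comp_pathMap hξ 0 0 n (hF.integrable (by norm_num))
  have h2 : partialSum f coord n ∘ pathMap ξ 0
      = ∑ i ∈ Finset.Icc 1 n, fun ω => f (ξ (i : ℤ) ω) := by
    rw [partialSum_comp_pathMap_zero]
    ext ω
    simp [partialSum]
  have h3 : condPair P ξ 0 n (partialSum f coord n ∘ pathMap ξ 0)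
      =ᵐ[P] ∑ i ∈ Finset.Icc 1 n, condPair P ξ 0 n fun ω => f (ξ (i : ℤ) ω) := by
    rw [h2]
    exact condExp_finsetSum (fun i _ => (hY i).integrable (by norm_num)) _
  simp only [Nat.cast_zero, add_zero] at h1
  rw [← l2_comp hφ (memLp_blockMean hξ hf2 n).1]
  calc l2 P (blockMean P ξ f n ∘ pathMap ξ 0)
      = l2 P (∑ i ∈ Finset.Icc 1 n, condPair P ξ 0 n fun ω => f (ξ (i : ℤ) ω)) :=
        l2_congr (EventuallyEq.trans h1 h3)
    _ ≤ ∑ i ∈ Finset.Icc 1 n, l2 P (condPair P ξ 0 n fun ω => f (ξ (i : ℤ) ω)) :=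
        l2_sum_le _ fun i _ => (hY i).condExp (by norm_num)
    _ ≤ ∑ i ∈ Finset.Icc 1 n, (w i + w (n - i)) := by
        refine Finset.sum_le_sum fun i hi => ?_
        have hi' := Finset.mem_Icc.1 hi
        rcases le_total i (n - i) with h | h
        · exact (l2_condPair_le hξ hf hf2 le_rfl (by omega)).trans
            (le_add_of_nonneg_right (hw0 _))
        · exact (l2_condPair_le hξ hf hf2 (j := n - i) h (by omega)).trans
            (le_add_of_nonneg_left (hw0 _))
    _ ≤ ∑ i ∈ Finset.range (n + 1), (w i + w (n - i)) :=
        Finset.sum_le_sum_of_subset_of_nonneg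
          (fun i hi => Finset.mem_range.2 (by have := Finset.mem_Icc.1 hi; omega))
          fun i _ _ => add_nonneg (hw0 _) (hw0 _)
    _ = 2 * ∑ j ∈ Finset.range (n + 1), w j := by
        rw [Finset.sum_add_distrib, two_mul]
        congr 1
        have := Finset.sum_range_reflect w (n + 1)
        simpa using this

lemma tendsto_l2_blockMean_sq_div (hξ : IsStationaryMarkovChain P ξ) (hf : Measurable f)
    (hf2 : MemLp f 2 (P.map (ξ 0)))
    (hcond : Tendsto (fun n : ℕ => (n : ℝ) *
        sqNorm P (condPair P ξ (-(n : ℤ)) (n : ℤ) (fun ω => f (ξ 0 ω)))) atTop (𝓝 0)) :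
    Tendsto (fun n : ℕ => l2 (pathLaw P ξ) (blockMean P ξ f n) ^ 2 / n) atTop (𝓝 0) := by
  have := hξ.isProbabilityMeasure_pathLaw
  set w : ℕ → ℝ := fun j =>
    l2 (pathLaw P ξ) (condPair (pathLaw P ξ) coord (-(j : ℤ)) j fun x => f (x 0)) with hw
  have hφ := hξ.measurePreserving_pathMap 0
  have hX : MemLp (fun x : ℤ → S => f (x 0)) 2 (pathLaw P ξ) := hξ.memLp_coord hf2 0
  have hwsq : ∀ n : ℕ, sqNorm P (condPair P ξ (-(n : ℤ)) (n : ℤ) (fun ω => f (ξ 0 ω)))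
      = w n ^ 2 := by
    intro n
    have h1 := condPair_comp_pathMap hξ 0 (-(n : ℤ)) n (hX.integrable (by norm_num))
    simp only [Nat.cast_zero, add_zero] at h1
    have h2 : (fun x : ℤ → S => f (x 0)) ∘ pathMap ξ 0 = fun ω => f (ξ 0 ω) := by
      ext ω; simp [pathMap]
    rw [h2] at h1
    have hY : MemLp (fun ω => f (ξ 0 ω)) 2 P := h2 ▸ hX.comp_measurePreserving hφ
    have hcY : MemLp (condPair P ξ (-(n : ℤ)) (n : ℤ) (fun ω => f (ξ 0 ω))) 2 P :=
      hY.condExp (by norm_num)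
    have hcm : AEStronglyMeasurable (condPair (pathLaw P ξ) coord (-(n : ℤ)) n
        fun x => f (x 0)) (pathLaw P ξ) := integrable_condExp.1
    rw [sqNorm, ← l2_sq hcY, hw]
    simp only
    rw [← l2_comp hφ hcm, l2_congr h1]
  simp only [hwsq] at hcond
  have h1 := (tendsto_add_atTop_iff_nat 1).2 (tendsto_sum_div_sqrt hcond)
  -- The constant `16` is `4` from squaring the factor `2` of `l2_blockMean_le`, times `4` to pass
  -- from `n + 1` to `n`.
  have h2 : Tendsto (fun n : ℕ => 8 * (2 * ((∑ j ∈ Finset.range (n + 1), w j)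
      / √((n + 1 : ℕ) : ℝ)) ^ 2)) atTop (𝓝 0) := by
    simpa using ((h1.pow 2).const_mul 2).const_mul 8
  refine squeeze_zero' (Eventually.of_forall fun n => by positivity) ?_ h2
  filter_upwards [eventually_ge_atTop 1] with n hn
  have hn' : (1 : ℝ) ≤ n := by exact_mod_cast hn
  have h3 := l2_blockMean_le hξ hf hf2 n
  have h4 : l2 (pathLaw P ξ) (blockMean P ξ f n) ^ 2
      ≤ (2 * ∑ j ∈ Finset.range (n + 1), w j) ^ 2 := pow_le_pow_left₀ (l2_nonneg _) h3 2
  rw [div_pow, Real.sq_sqrt (by positivity), div_le_iff₀ (by linarith)]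
  refine h4.trans ?_
  have hW := sq_nonneg (∑ j ∈ Finset.range (n + 1), w j)
  have h5 : (1 : ℝ) ≤ 4 * (n / ((n + 1 : ℕ) : ℝ)) := by
    push_cast
    rw [← mul_div_assoc, le_div_iff₀ (by positivity)]
    linarith
  calc (2 * ∑ j ∈ Finset.range (n + 1), w j) ^ 2
      = 4 * (∑ j ∈ Finset.range (n + 1), w j) ^ 2 * 1 := by ring
    _ ≤ 4 * (∑ j ∈ Finset.range (n + 1), w j) ^ 2 * (4 * (n / ((n + 1 : ℕ) : ℝ))) :=
        mul_le_mul_of_nonneg_left h5 (by positivity)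
    _ = _ := by ring

/-- For fixed `m` the noises obey the limit theorem with variance `a / m`, and the block means
contribute at most `|t| √(v - a / m)` in the limit. Both errors disappear as `m` grows because `ha`
and `hu` have the same limit `v`. -/
theorem tendsto_integral_cis_partialSum (hξ : IsStationaryMarkovChain P ξ)
    (herg : IsTotallyErgodic P ξ) (hf : Measurable f) (hf2 : MemLp f 2 (P.map (ξ 0))) {v : ℝ}
    (ha : Tendsto (fun n : ℕ => (∫ x, blockNoise P ξ f n x ^ 2 ∂(pathLaw P ξ)) / n) atTop (𝓝 v))
    (hu : Tendsto (fun n : ℕ => (∫ x, partialSum f coord n x ^ 2 ∂(pathLaw P ξ)) / n)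
      atTop (𝓝 v)) (t : ℝ) :
    Tendsto (fun n : ℕ => ∫ x, cis (t / √(n : ℝ) * partialSum f coord n x) ∂(pathLaw P ξ)) atTop
      (𝓝 (Real.exp (-(t ^ 2 * v / 2)) : ℂ)) := by
  have := hξ.isProbabilityMeasure_pathLaw
  set μ := pathLaw P ξ with hμ
  have hF := hξ.memLp_partialSum hf2
  obtain ⟨L, hL⟩ := hu.bddAbove_range
  have hbound : ∀ n : ℕ, l2 μ (partialSum f coord n) ≤ √L * √(n : ℝ) := by
    intro n
    rw [l2_eq_sqrt (hF n), ← Real.sqrt_mul' _ (Nat.cast_nonneg n)]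
    refine Real.sqrt_le_sqrt ?_
    rcases Nat.eq_zero_or_pos n with rfl | hn
    · simp [partialSum]
    · have hn' : (0 : ℝ) < n := by exact_mod_cast hn
      exact (div_le_iff₀ hn').1 (hL ⟨n, rfl⟩)
  have hstep : ∀ n : ℕ, l2 μ (partialSum f coord (n + 1) - partialSum f coord n)
      ≤ l2 μ (fun x : ℤ → S => f (x 1)) := by
    intro n
    have : partialSum f coord (n + 1) - partialSum f coord n
        = (fun x : ℤ → S => f (x 1)) ∘ shift^[n] := by
      ext x; simp [partialSum_eq_birkhoffSum, birkhoffSum_succ]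
    have h1 : MemLp (fun x : ℤ → S => f (x 1)) 2 μ := hξ.memLp_coord hf2 1
    rw [this, l2_comp (hξ.measurePreserving_shift.iterate n) h1.1]
  rw [Metric.tendsto_atTop]
  intro ε hε
  have hc1 : Tendsto (fun m : ℕ => |t| * √(v - (∫ x, blockNoise P ξ f m x ^ 2 ∂μ) / m)) atTop
      (𝓝 0) := by
    simpa using ((tendsto_const_nhds (x := v)).sub ha).sqrt.const_mul |t|
  have hc2 : Tendsto (fun m : ℕ =>
      ‖(Real.exp (-(t ^ 2 * ((∫ x, blockNoise P ξ f m x ^ 2 ∂μ) / m) / 2)) : ℂ)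
        - (Real.exp (-(t ^ 2 * v / 2)) : ℂ)‖) atTop (𝓝 0) := by
    have hcont : Continuous fun y : ℝ => (Real.exp (-(t ^ 2 * y / 2)) : ℂ) := by fun_prop
    have := (((hcont.tendsto v).comp ha).sub_const (Real.exp (-(t ^ 2 * v / 2)) : ℂ)).norm
    simpa using this
  -- `m` is fixed before `n`. The four quarters of `ε` go to the rounding of `n`, the block means,
  -- the limit theorem for the noises, and the change of variance from `a / m` to `v`.
  obtain ⟨m, ⟨hm0, hm1⟩, hm2⟩ := (((eventually_gt_atTop 0).and
    (hc1.eventually_lt_const (show (0 : ℝ) < ε / 4 by linarith))).and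
    (hc2.eventually_lt_const (show (0 : ℝ) < ε / 4 by linarith))).exists
  have hm' : (0 : ℝ) < m := by exact_mod_cast hm0
  set a := ∫ x, blockNoise P ξ f m x ^ 2 ∂μ with hadef
  have hT := hξ.measurePreserving_shift.iterate m
  have hNs := memLp_birkhoffSum hT (memLp_blockNoise hξ hf2 m)
  have hMs := memLp_birkhoffSum hT (memLp_blockMean hξ hf2 m)
  have hclt := tendsto_integral_cis_birkhoffSum (herg m hm0) (memLp_blockNoise hξ hf2 m)
    (fun t n j hnj => integral_cis_mul_blockNoise hξ hf hf2 m t hnj)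
    (fun t n i j hni hij => integral_cis_mul_blockNoise_mul hξ hf hf2 m t hni hij) (t / √(m : ℝ))
  have hlimit : (t / √(m : ℝ)) ^ 2 * (∫ x, blockNoise P ξ f m x ^ 2 ∂μ) / 2
      = t ^ 2 * (a / m) / 2 := by
    rw [div_pow, Real.sq_sqrt hm'.le, hadef]
    ring
  rw [hlimit] at hclt
  have hdiv : ∀ k : ℕ, t / √(m : ℝ) / √(k : ℝ) = t / √((m * k : ℕ) : ℝ) := fun k => by
    push_cast
    rw [Real.sqrt_mul hm'.le, div_div]
  simp only [hdiv] at hclt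
  have happrox : ∀ k : ℕ, ‖∫ x, cis (t / √((m * k : ℕ) : ℝ) * partialSum f coord (m * k) x) ∂μ
      - ∫ x, cis (t / √((m * k : ℕ) : ℝ) * birkhoffSum (shift^[m]) (blockNoise P ξ f m) k x) ∂μ‖
      ≤ |t| * √((∫ x, partialSum f coord (m * k) x ^ 2 ∂μ) / ((m * k : ℕ) : ℝ)
        - k * a / ((m * k : ℕ) : ℝ)) := by
    intro k
    refine (norm_integral_cis_sub_le (hF (m * k)) (hNs k) _).trans ?_
    have h1 : partialSum f coord (m * k) - birkhoffSum (shift^[m]) (blockNoise P ξ f m) k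
        = birkhoffSum (shift^[m]) (blockMean P ξ f m) k := by
      rw [partialSum_mul_eq_birkhoffSum (P := P) (ξ := ξ), add_sub_cancel_left]
    rw [h1, ← sub_div, ← l2_sq_birkhoffSum_blockMean hξ hf hf2 m k, Real.sqrt_div (sq_nonneg _),
      Real.sqrt_sq (l2_nonneg _), abs_div, abs_of_nonneg (Real.sqrt_nonneg _)]
    exact le_of_eq (by ring)
  have hmul : Tendsto (fun k : ℕ => m * k) atTop atTop :=
    tendsto_id.const_mul_atTop' hm0
  have happrox_lim : Tendsto (fun k : ℕ =>
      |t| * √((∫ x, partialSum f coord (m * k) x ^ 2 ∂μ) / ((m * k : ℕ) : ℝ)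
        - k * a / ((m * k : ℕ) : ℝ))) atTop (𝓝 (|t| * √(v - a / m))) := by
    have h1 := hu.comp hmul
    have h2 : Tendsto (fun k : ℕ => (k : ℝ) * a / ((m * k : ℕ) : ℝ)) atTop (𝓝 (a / m)) := by
      refine tendsto_const_nhds.congr' ?_
      filter_upwards [eventually_gt_atTop 0] with k hk
      have hk' : (0 : ℝ) < k := by exact_mod_cast hk
      push_cast
      field_simp
    exact ((h1.sub h2).sqrt).const_mul |t|
  have hk := Nat.tendsto_div_const_atTop hm0.ne'
  have hev1 := (happrox_lim.comp hk).eventually_lt_const hm1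
  have hev2 := Metric.tendsto_nhds.1 (hclt.comp hk) (ε / 4) (by linarith)
  have hev3 := (tendsto_integral_cis_block (P := μ) hF hstep hbound hm0 t).norm.eventually_lt_const
    (show ‖(0 : ℂ)‖ < ε / 4 by simpa using hε)
  obtain ⟨N, hN⟩ := eventually_atTop.1 ((hev1.and hev2).and hev3)
  refine ⟨N, fun n hn => ?_⟩
  obtain ⟨⟨g1, g2⟩, g3⟩ := hN n hn
  have g4 := happrox (n / m)
  simp only [Function.comp_apply] at g1 g2
  rw [dist_eq_norm] at g2 ⊢
  set A := ∫ x, cis (t / √(n : ℝ) * partialSum f coord n x) ∂μ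
  set B := ∫ x, cis (t / √((m * (n / m) : ℕ) : ℝ) * partialSum f coord (m * (n / m)) x) ∂μ
  set C := ∫ x, cis (t / √((m * (n / m) : ℕ) : ℝ)
    * birkhoffSum (shift^[m]) (blockNoise P ξ f m) (n / m) x) ∂μ
  calc ‖A - (Real.exp (-(t ^ 2 * v / 2)) : ℂ)‖
      = ‖(A - B) + (B - C) + (C - (Real.exp (-(t ^ 2 * (a / m) / 2)) : ℂ))
        + ((Real.exp (-(t ^ 2 * (a / m) / 2)) : ℂ) - (Real.exp (-(t ^ 2 * v / 2)) : ℂ))‖ := by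
        congr 1; ring
    _ ≤ ‖A - B‖ + ‖B - C‖ + ‖C - (Real.exp (-(t ^ 2 * (a / m) / 2)) : ℂ)‖
        + ‖(Real.exp (-(t ^ 2 * (a / m) / 2)) : ℂ) - (Real.exp (-(t ^ 2 * v / 2)) : ℂ)‖ :=
        (norm_add_le _ _).trans (add_le_add_left norm_add₃_le _)
    _ < ε := by linarith

/-- The noise of a block has an asymptotic variance per unit of time. -/
lemma exists_tendsto_blockNoise_div (hξ : IsStationaryMarkovChain P ξ)
    (hf : Measurable f) (hf2 : MemLp f 2 (P.map (ξ 0)))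
    (hvar : ∃ C : ℝ, ∀ n : ℕ, 1 ≤ n →
      (∫ x, partialSum f coord n x ^ 2 ∂(pathLaw P ξ)) / n ≤ C) :
    ∃ v : ℝ≥0, Tendsto (fun n : ℕ => (∫ x, blockNoise P ξ f n x ^ 2 ∂(pathLaw P ξ)) / n) atTop
      (𝓝 (v : ℝ)) := by
  obtain ⟨C, hC⟩ := hvar
  -- Fekete's lemma for the negated variances; the assumed bound on `E(S_n²)/n` keeps the limit
  -- finite.
  have hsub : Subadditive fun n : ℕ => -∫ x, blockNoise P ξ f n x ^ 2 ∂(pathLaw P ξ) := by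
    intro m n
    linarith [blockNoise_superadditive hξ hf hf2 m n]
  have hbdd : BddBelow (Set.range fun n : ℕ =>
      (-∫ x, blockNoise P ξ f n x ^ 2 ∂(pathLaw P ξ)) / n) := by
    -- The maximum covers `n = 0`, where the quotient is `0` by convention and `C` gives no
    -- information.
    refine ⟨-max C 0, ?_⟩
    rintro _ ⟨n, rfl⟩
    rcases Nat.eq_zero_or_pos n with rfl | hn
    · simp
    · have hn' : (0 : ℝ) < n := by exact_mod_cast hn
      simp only [neg_div, neg_le_neg_iff]
      refine le_max_of_le_left (le_trans ?_ (hC n hn))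
      refine div_le_div_of_nonneg_right ?_ hn'.le
      rw [integral_sq_partialSum hξ hf2]
      exact le_add_of_nonneg_right (sq_nonneg _)
  have hlim := (hsub.tendsto_lim hbdd).neg
  simp only [neg_div, neg_neg] at hlim
  have h0 : 0 ≤ -hsub.lim := ge_of_tendsto' hlim fun n =>
    div_nonneg (integral_nonneg fun x => sq_nonneg _) (Nat.cast_nonneg n)
  exact ⟨⟨-hsub.lim, h0⟩, hlim⟩

end Limits

end MarkovCLT

/-! ### The central limit theorem -/

theorem proposition5 {Ω S : Type*} [MeasurableSpace Ω] [MeasurableSpace S]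
    (P : Measure Ω) [IsProbabilityMeasure P] (ξ : ℤ → Ω → S)
    (hξ : MarkovCLT.IsStationaryMarkovChain P ξ)
    (herg : MarkovCLT.IsTotallyErgodic P ξ)
    (f : S → ℝ) (hf : Measurable f)
    (hf2 : MemLp f 2 (P.map (ξ 0))) (hf0 : ∫ x, f x ∂(P.map (ξ 0)) = 0)
    (hvar : ∃ C : ℝ, ∀ n : ℕ, 1 ≤ n →
      (∫ ω, (MarkovCLT.partialSum f ξ n ω) ^ 2 ∂P) / n ≤ C)
    (hcond : Tendsto
      (fun n : ℕ => (n : ℝ) *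
        MarkovCLT.sqNorm P (MarkovCLT.condPair P ξ (-(n : ℤ)) (n : ℤ) (fun ω => f (ξ 0 ω))))
      atTop (𝓝 0)) :
    ∃ v : ℝ≥0,
      Tendsto
        (fun n : ℕ => (1 / (n : ℝ)) *
          MarkovCLT.sqNorm P (fun ω => MarkovCLT.partialSum f ξ n ω -
            MarkovCLT.condPair P ξ 0 (n : ℤ) (MarkovCLT.partialSum f ξ n) ω))
        atTop (𝓝 (v : ℝ)) ∧
      Tendsto
        (fun n : ℕ => (∫ ω, (MarkovCLT.partialSum f ξ n ω) ^ 2 ∂P) / n)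
        atTop (𝓝 (v : ℝ)) ∧
      TendstoInDistribution
        (fun (n : ℕ) (ω : Ω) => MarkovCLT.partialSum f ξ n ω / √(n : ℝ))
        atTop (id : ℝ → ℝ) (fun _ => P) (gaussianReal 0 v) := by
  have := hξ.isProbabilityMeasure_pathLaw
  have hF := hξ.memLp_partialSum hf2
  have hφ := hξ.measurePreserving_pathMap 0
  have hsum : ∀ n ω, MarkovCLT.partialSum f MarkovCLT.coord n (MarkovCLT.pathMap ξ 0 ω)
      = MarkovCLT.partialSum f ξ n ω := fun n ω =>
    congrFun (MarkovCLT.partialSum_comp_pathMap_zero f n) ω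
  have hvar_eq : ∀ n, ∫ ω, (MarkovCLT.partialSum f ξ n ω) ^ 2 ∂P
      = ∫ x, (MarkovCLT.partialSum f MarkovCLT.coord n x) ^ 2 ∂(MarkovCLT.pathLaw P ξ) := by
    intro n
    rw [MarkovCLT.integral_pathLaw hξ (hF n).integrable_sq.1]
    simp only [hsum]
  simp only [hvar_eq] at hvar
  obtain ⟨v, hv⟩ := MarkovCLT.exists_tendsto_blockNoise_div hξ hf hf2 hvar
  -- By Pythagoras the second moment is noise variance plus squared norm of the mean, and the latter
  -- is `o(n)`.
  have hu : Tendsto (fun n : ℕ => (∫ x, (MarkovCLT.partialSum f MarkovCLT.coord n x) ^ 2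
      ∂(MarkovCLT.pathLaw P ξ)) / n) atTop (𝓝 (v : ℝ)) := by
    have := hv.add (MarkovCLT.tendsto_l2_blockMean_sq_div hξ hf hf2 hcond)
    simp only [← add_div, ← MarkovCLT.integral_sq_partialSum hξ hf2, add_zero] at this
    exact this
  refine ⟨v, ?_, ?_, ?_⟩
  · refine hv.congr fun n => ?_
    have h1 := MarkovCLT.condPair_comp_pathMap hξ 0 0 n ((hF n).integrable (by norm_num))
    simp only [Nat.cast_zero, add_zero] at h1
    rw [MarkovCLT.partialSum_comp_pathMap_zero] at h1
    rw [MarkovCLT.integral_pathLaw hξ (MarkovCLT.memLp_blockNoise hξ hf2 n).integrable_sq.1,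
      MarkovCLT.sqNorm, div_eq_inv_mul, one_div]
    congr 1
    refine integral_congr_ae ?_
    filter_upwards [h1] with ω hω
    have h2 : MarkovCLT.blockMean P ξ f n (MarkovCLT.pathMap ξ 0 ω) = _ := hω
    simp only [MarkovCLT.blockNoise, h2, hsum]
  · simpa only [hvar_eq] using hu
  · have hm : ∀ n : ℕ, AEMeasurable (fun ω => MarkovCLT.partialSum f ξ n ω / √(n : ℝ)) P := by
      intro n
      have := ((hF n).comp_measurePreserving hφ).1.aemeasurable
      rw [MarkovCLT.partialSum_comp_pathMap_zero] at this
      exact this.div_const _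
    refine ⟨hm, aemeasurable_id, ?_⟩
    -- Lévy's continuity theorem; the degenerate case `v = 0` needs no separate treatment.
    refine ProbabilityMeasure.tendsto_iff_tendsto_charFun.2 fun t => ?_
    have hlim := MarkovCLT.tendsto_integral_cis_partialSum hξ herg hf hf2 hv hu t
    have hgauss : charFun (Measure.map id (gaussianReal 0 v)) t
        = (Real.exp (-(t ^ 2 * v / 2)) : ℂ) := by
      rw [Measure.map_id, charFun_gaussianReal]
      push_cast
      congr 1
      simp
      ring
    refine (hgauss.symm ▸ hlim).congr fun n => ?_
    change _ = charFun (P.map fun ω => MarkovCLT.partialSum f ξ n ω / √(n : ℝ)) t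
    rw [charFun_apply_real, integral_map (hm n)
      (by fun_prop : Continuous fun x : ℝ => Complex.exp (t * x * Complex.I)).aestronglyMeasurable,
      MarkovCLT.integral_pathLaw hξ (MarkovCLT.integrable_cis (hF n).1 _).1]
    refine integral_congr_ae (ae_of_all _ fun ω => ?_)
    simp only [hsum, MarkovCLT.cis]
    congr 1
    push_cast
    ring
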